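/- **Optimal bipartite extraction rate with converse error exponent.** All logarithms have base 2, and all Hilbert spaces are finite dimensional. An LOCC channel between two parties is a finite composition of one-step channels. In each step one party $i$ reads a finite classical register, applies Kraus operators $K_j$ ($j\in J$, $J$ finite) to its own system and rewrites the register, $\rho\mapsto\sum_{j}\big((K_j)_i\otimes|g(j)\rangle\langle f(j)|\big)\,\rho\,\big((K_j^*)_i\otimes|f(j)\rangle\langle g(j)|\big)$, where $\sum_j K_j^*K_j\otimes|f(j)\rangle\langle f(j)|\le I$. For (unnormalised) bipartite vectors write $|\psi\rangle\xrightarrow{\mathrm{LOCC}}|\phi\rangle$ if some LOCC channel maps $|\psi\rangle\langle\psi|$ to $|\phi\rangle\langle\phi|$ (with one-point registers at the beginning and at the end). For $r\ge 0$ let $$E^*(r,\psi,\phi)=\sup\Big\{\tau\ge 0\ \Big|\ 2^{nr/2+o(n)}|\psi\rangle^{\otimes n}\xrightarrow{\mathrm{LOCC}}|\phi\rangle^{\otimes\lfloor\tau n\rfloor}\text{ for all sufficiently large } n\Big\},$$ the optimal number of exact copies of $\phi$ that can be extracted per copy of $\psi$ with success probability $2^{-nr+o(n)}$; here $o(n)$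 stands for some real sequence $(\delta_n)$, which may depend on $\tau$, with $\delta_n/n\to0$. Let $\psi$ and $\phi$ be bipartite pure states with Schmidt decompositions $\psi=\sum_{i=1}^{d_1}\sqrt{p_i}\,|u_i\rangle\otimes|v_i\rangle$ and $\phi=\sum_{i=1}^{d_2}\sqrt{q_i}\,|u'_i\rangle\otimes|v'_i\rangle$, where the families $(u_i)$, $(v_i)$, $(u'_i)$, $(v'_i)$ are orthonormal and $P=(p_i)$, $Q=(q_i)$ are probability distributions. Suppose that $\phi$ is entangled, i.e. $q_i\neq1$ for all $i$. Then for every $r\ge0$ $$E^*(r,\psi,\phi)=\inf_{\alpha\in[0,1)}\frac{r\alpha+\log\sum_i p_i^\alpha}{\log\sum_i q_i^\alpha}=\inf_{\alpha\in[0,1)}\frac{r\frac{\alpha}{1-\alpha}+H_\alpha(P)}{H_\alpha(Q)},$$ where $H_\alpha(P)=\frac1{1-\alpha}\log\sum_i p_i^\alpha$ is the Rényi entropy and the sums run over the indices with $p_i\ne0$ and $q_i\neq 0$ respectively (so that for $\alpha=0$ they are the Schmidt ranks). In particular, if the target is the Bell state $\phi=\frac1{\sqrt2}(|00\rangle+|11\rangle)$,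 then $$E^*(r,\psi,\phi)=\inf_{\alpha\in[0,1)}\frac{r\alpha+\log\sum_i p_i^\alpha}{1-\alpha}=\inf_{\alpha\in[0,1)}\Big(r\tfrac{\alpha}{1-\alpha}+H_\alpha(P)\Big).$$ -/

import Mathlib

open scoped Kronecker ComplexOrder

namespace BipartiteLOCC

/-- A bipartite state space with a classical register: the finite-dimensional Hilbert spaces
`ℂ^A` and `ℂ^B` of the two parties and the finite register `X`. -/
structure StateSpace where
  A : Type
  B : Type
  X : Type
  [fintypeA : Fintype A]
  [fintypeB : Fintype B]
  [fintypeX : Fintype X]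
  [decEqA : DecidableEq A]
  [decEqB : DecidableEq B]
  [decEqX : DecidableEq X]

attribute [instance] StateSpace.fintypeA StateSpace.fintypeB StateSpace.fintypeX
  StateSpace.decEqA StateSpace.decEqB StateSpace.decEqX

/-- The operators in `𝓑(ℂ^A) ⊗ 𝓑(ℂ^B) ⊗ Diag(ℂ^X)`: the element `∑ x, ρ x ⊗ |x⟩⟨x|` is given by
its diagonal blocks `ρ x`, which are operators on `ℂ^A ⊗ ℂ^B = ℂ^(A × B)`. -/
abbrev StateSpace.Op (S : StateSpace) : Type :=
  S.X → Matrix (S.A × S.B) (S.A × S.B) ℂ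

/-- The condition `∑ j, (K j)* (K j) ⊗ |f j⟩⟨f j| ≤ I` on Kraus operators `K j : ℂ^H → ℂ^H'` that
are applied when the register shows `f j`, written out on every block `x` of the register. -/
def KrausBound {H H' X J : Type} [Fintype H] [Fintype H'] [DecidableEq H] [DecidableEq X]
    [Fintype J] (K : J → Matrix H' H ℂ) (f : J → X) : Prop :=
  ∀ x : X, (1 - ∑ j with f j = x, (K j).conjTranspose * K j).PosSemidef

/-- The one-step channel of the first party,
`ρ ↦ ∑ j, (K j ⊗ I ⊗ |g j⟩⟨f j|) ρ ((K j)* ⊗ I ⊗ |f j⟩⟨g j|)`. -/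
def stepA {A B X A' Y J : Type} [Fintype A] [Fintype B] [DecidableEq B] [DecidableEq Y]
    [Fintype J] (K : J → Matrix A' A ℂ) (f : J → X) (g : J → Y)
    (ρ : X → Matrix (A × B) (A × B) ℂ) : Y → Matrix (A' × B) (A' × B) ℂ :=
  fun y => ∑ j with g j = y,
    (K j ⊗ₖ (1 : Matrix B B ℂ)) * ρ (f j) * (K j ⊗ₖ (1 : Matrix B B ℂ)).conjTranspose

/-- The one-step channel of the second party,
`ρ ↦ ∑ j, (I ⊗ K j ⊗ |g j⟩⟨f j|) ρ (I ⊗ (K j)* ⊗ |f j⟩⟨g j|)`. -/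
def stepB {A B X B' Y J : Type} [Fintype A] [Fintype B] [DecidableEq A] [DecidableEq Y]
    [Fintype J] (K : J → Matrix B' B ℂ) (f : J → X) (g : J → Y)
    (ρ : X → Matrix (A × B) (A × B) ℂ) : Y → Matrix (A × B') (A × B') ℂ :=
  fun y => ∑ j with g j = y,
    ((1 : Matrix A A ℂ) ⊗ₖ K j) * ρ (f j) * ((1 : Matrix A A ℂ) ⊗ₖ K j).conjTranspose

/-- LOCC channels (trace non-increasing): the compositions of finitely many one-step channels,
each acting on the space of one party and on the classical register. -/
inductive IsLOCC : (S T : StateSpace) → (S.Op → T.Op) → Prop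
  | refl (S : StateSpace) : IsLOCC S S (fun ρ => ρ)
  | stepA {S T : StateSpace} {Λ : S.Op → T.Op} (h : IsLOCC S T Λ) (A' Y J : Type)
      [Fintype A'] [DecidableEq A'] [Fintype Y] [DecidableEq Y] [Fintype J]
      (K : J → Matrix A' T.A ℂ) (f : J → T.X) (g : J → Y) (hK : KrausBound K f) :
      IsLOCC S (StateSpace.mk A' T.B Y) (fun ρ => BipartiteLOCC.stepA K f g (Λ ρ))
  | stepB {S T : StateSpace} {Λ : S.Op → T.Op} (h : IsLOCC S T Λ) (B' Y J : Type)
      [Fintype B'] [DecidableEq B'] [Fintype Y] [DecidableEq Y] [Fintype J]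
      (K : J → Matrix B' T.B ℂ) (f : J → T.X) (g : J → Y) (hK : KrausBound K f) :
      IsLOCC S (StateSpace.mk T.A B' Y) (fun ρ => BipartiteLOCC.stepB K f g (Λ ρ))

/-- The unnormalised pure state `|ψ⟩⟨ψ|`, with a one-point register. -/
def pureState {A B : Type} (ψ : A × B → ℂ) : Unit → Matrix (A × B) (A × B) ℂ :=
  fun _ => Matrix.vecMulVec ψ (star ψ)

/-- `|ψ⟩ → |φ⟩` under LOCC, for unnormalised vectors. -/
def LOCCConvertible {A B C D : Type} [Fintype A] [Fintype B] [Fintype C] [Fintype D]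
    [DecidableEq A] [DecidableEq B] [DecidableEq C] [DecidableEq D]
    (ψ : A × B → ℂ) (φ : C × D → ℂ) : Prop :=
  ∃ Λ : (StateSpace.mk A B Unit).Op → (StateSpace.mk C D Unit).Op,
    IsLOCC (StateSpace.mk A B Unit) (StateSpace.mk C D Unit) Λ ∧ Λ (pureState ψ) = pureState φ

/-- `|ψ⟩^{⊗ n}`, a bipartite vector in `(ℂ^A)^{⊗ n} ⊗ (ℂ^B)^{⊗ n}`. -/
def tensorPow {A B : Type} (ψ : A × B → ℂ) (n : ℕ) : (Fin n → A) × (Fin n → B) → ℂ :=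
  fun x => ∏ i, ψ (x.1 i, x.2 i)

/-- The rates `τ ≥ 0` such that `2^{nr/2 + o(n)} |ψ⟩^{⊗ n} → |φ⟩^{⊗ ⌊τ n⌋}` for all sufficiently
large `n`, that is (for unit vectors): `⌊τ n⌋` exact copies of `φ` are extracted from `n` copies of
`ψ` with success probability `2^{-nr + o(n)}`. -/
def achievableRates {A B C D : Type} [Fintype A] [Fintype B] [Fintype C] [Fintype D]
    [DecidableEq A] [DecidableEq B] [DecidableEq C] [DecidableEq D]
    (r : ℝ) (ψ : A × B → ℂ) (φ : C × D → ℂ) : Set ℝ :=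
  {τ | 0 ≤ τ ∧ ∃ δ : ℕ → ℝ, Asymptotics.IsLittleO Filter.atTop δ (fun n : ℕ => (n : ℝ)) ∧
    ∀ᶠ n : ℕ in Filter.atTop,
      LOCCConvertible ((((2 : ℝ) ^ ((n : ℝ) * r / 2 + δ n) : ℝ) : ℂ) • tensorPow ψ n)
        (tensorPow φ ⌊τ * (n : ℝ)⌋₊)}

/-- The optimal extraction rate `E*(r, ψ, φ)`, a supremum in the extended reals. -/
noncomputable def extractionRate {A B C D : Type} [Fintype A] [Fintype B] [Fintype C] [Fintype D]
    [DecidableEq A] [DecidableEq B] [DecidableEq C] [DecidableEq D]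
    (r : ℝ) (ψ : A × B → ℂ) (φ : C × D → ℂ) : EReal :=
  ⨆ τ ∈ achievableRates r ψ φ, (τ : EReal)

/-- `ψ = ∑ i, √(p i) |u i⟩ ⊗ |v i⟩` for orthonormal families `u` and `v`. -/
def HasSchmidtDistribution {A B : Type} [Fintype A] [Fintype B] {d : ℕ}
    (ψ : A × B → ℂ) (P : Fin d → ℝ) : Prop :=
  ∃ (u : Fin d → EuclideanSpace ℂ A) (v : Fin d → EuclideanSpace ℂ B),
    Orthonormal ℂ u ∧ Orthonormal ℂ v ∧
      ∀ a b, ψ (a, b) = ∑ i, ((Real.sqrt (P i) : ℝ) : ℂ) * (u i a * v i b)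

/-- The Bell state `(|00⟩ + |11⟩) / √2`. -/
noncomputable def bellState : Fin 2 × Fin 2 → ℂ :=
  fun x => if x.1 = x.2 then ((1 / Real.sqrt 2 : ℝ) : ℂ) else 0

/-- `∑ p i ^ α` over the `i` with `p i ≠ 0`; at `α = 0` this is the size of the support. -/
noncomputable def powerSum {d : ℕ} (P : Fin d → ℝ) (α : ℝ) : ℝ :=
  ∑ i with P i ≠ 0, P i ^ α

/-- The Rényi entropy of order `α ≠ 1`, in bits. -/
noncomputable def renyiEntropy {d : ℕ} (α : ℝ) (P : Fin d → ℝ) : ℝ :=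
  1 / (1 - α) * Real.logb 2 (powerSum P α)

end BipartiteLOCC

/-! Converse. For `0 < α < 1` the Schmidt coefficients `l` (squared amplitudes) of a bipartite
vector give the quasi-norm `(∑ l ^ α) ^ (1 / α)`. After a local Kraus operator the new coefficients
are controlled by the diagonal of a reduced state (`sum_rpow_le_of_schmidtForm_applyA`), and reverse
Minkowski then shows that the quasi-norms of all outcomes of a local measurement add up to at most
the initial one. So the total over an ensemble of pure states never grows under LOCC
(`IsLOCC.hasDecomposition`). An ensemble for a pure target contains only multiples of it, whence `(∑
q ^ α) ^ m ≤ c ^ (2 * α) * (∑ p ^ α) ^ n` for an amplitude factor `c`. Logarithms divided by `n`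
give the upper bound, and `α = 0` follows by continuity.

Achievability. By Birkhoff's theorem it suffices to transport the target coefficients below the
source coefficients by a matrix with column sums 1 and row sums at most 1
(`convertible_of_transport`). The target sequences fall into polynomially many type classes. A class
of `N = e ^ a` sequences, each of probability `e ^ b`, is spread uniformly over sequences typical
for the tilted distribution proportional to `p ^ α`, with `α` chosen so that its entropy `h`
satisfies `n * h ≈ a`. The rate condition at this `α` bounds `N * (e ^ b) ^ α`. Since `h = log (∑ p
^ α) - α * m` with `m` the tilted mean of `log p`, it becomes `b ≤ n * r + n * m` up to `o(n)`,
which is the load condition. Classes too small for any tilt use `α = 1`. Strict inequality at `α =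
0` keeps the tilts away from 0, so the errors, which grow like `1 / α`, remain `o(n)`. -/

namespace BipartiteLOCC

/-! ### Inequalities for sums of powers -/

/-- Jensen's inequality for the concave function `x ↦ x ^ α` and sub-probability weights. -/
theorem sum_mul_rpow_le_rpow_sum {ι : Type*} [Fintype ι] {α : ℝ} (hα : 0 < α) (hα1 : α < 1)
    {w x : ι → ℝ} (hw : ∀ i, 0 ≤ w i) (hx : ∀ i, 0 ≤ x i) (hw1 : ∑ i, w i ≤ 1) :
    ∑ i, w i * x i ^ α ≤ (∑ i, w i * x i) ^ α := by
  -- Weighted Hölder with exponent `1 / α` leaves a factor `(∑ w) ^ (1 - α)`, which is at most 1.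
  have h := Real.inner_le_weight_mul_Lp_of_nonneg Finset.univ (p := α⁻¹)
    ((one_le_inv₀ hα).2 hα1.le) w (fun i => x i ^ α) hw (fun i => Real.rpow_nonneg (hx i) _)
  simp only [inv_inv, ← Real.rpow_mul (hx _), mul_inv_cancel₀ hα.ne', Real.rpow_one] at h
  refine h.trans (mul_le_of_le_one_left ?_ ?_)
  · exact Real.rpow_nonneg (Finset.sum_nonneg fun i _ => mul_nonneg (hw i) (hx i)) _
  · exact Real.rpow_le_one (Finset.sum_nonneg fun i _ => hw i) hw1 (by linarith)

/-- Minkowski's inequality for finitely many functions. -/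
theorem Lp_sum_le_of_nonneg {ι κ : Type*} [Fintype κ] (s : Finset ι) {p : ℝ} (hp : 1 ≤ p)
    {f : ι → κ → ℝ} (hf : ∀ i k, 0 ≤ f i k) :
    (∑ k, (∑ i ∈ s, f i k) ^ p) ^ (1 / p) ≤ ∑ i ∈ s, (∑ k, f i k ^ p) ^ (1 / p) := by
  classical
  induction s using Finset.induction_on with
  | empty =>
    have hp0 : p ≠ 0 := by linarith
    simp [Real.zero_rpow hp0, Real.zero_rpow (inv_ne_zero hp0)]
  | insert i s hi ih =>
    simp only [Finset.sum_insert hi]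
    exact (Real.Lp_add_le_of_nonneg Finset.univ hp (fun k _ => hf i k)
      (fun k _ => Finset.sum_nonneg fun j _ => hf j k)).trans (by gcongr)

/-- The reverse Minkowski inequality for exponents `0 < α < 1`. -/
theorem sum_rpow_sum_rpow_le {ι κ : Type*} [Fintype ι] [Fintype κ] {α : ℝ} (hα : 0 < α)
    (hα1 : α < 1) {d : κ → ι → ℝ} (hd : ∀ k i, 0 ≤ d k i) :
    ∑ k, (∑ i, d k i ^ α) ^ (1 / α) ≤ (∑ i, (∑ k, d k i) ^ α) ^ (1 / α) := by
  -- Minkowski in `ℓ ^ (1 / α)` for the functions `d ^ α`; raising to the power `1 / α` reverses its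
  -- role.
  have h := Lp_sum_le_of_nonneg Finset.univ (p := 1 / α)
    ((one_le_div hα).2 hα1.le) (f := fun i k => d k i ^ α) (fun i k => Real.rpow_nonneg (hd k i) _)
  simp only [one_div_one_div, ← Real.rpow_mul (hd _ _), mul_one_div_cancel hα.ne',
    Real.rpow_one] at h
  have h0 : 0 ≤ ∑ k, (∑ i, d k i ^ α) ^ (1 / α) := Finset.sum_nonneg fun k _ =>
    Real.rpow_nonneg (Finset.sum_nonneg fun i _ => Real.rpow_nonneg (hd k i) _) _
  have h2 := Real.rpow_le_rpow (Real.rpow_nonneg h0 _) h (one_div_nonneg.2 hα.le)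
  rwa [← Real.rpow_mul h0, mul_one_div_cancel hα.ne', Real.rpow_one] at h2

/-! ### Schmidt decompositions -/

/-- `χ = ∑ i, √(l i) |u i⟩ ⊗ |v i⟩` for orthonormal families `u` and `v` and nonnegative `l i`,
with an arbitrary finite index set. -/
def SchmidtForm {A B ι : Type*} [Fintype A] [Fintype B] [Fintype ι] (χ : A × B → ℂ)
    (l : ι → ℝ) : Prop :=
  (∀ i, 0 ≤ l i) ∧ ∃ (u : ι → EuclideanSpace ℂ A) (v : ι → EuclideanSpace ℂ B),
    Orthonormal ℂ u ∧ Orthonormal ℂ v ∧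
      ∀ a b, χ (a, b) = ∑ i, ((Real.sqrt (l i) : ℝ) : ℂ) * (u i a * v i b)

theorem inner_euclidean {A : Type*} [Fintype A] (x y : EuclideanSpace ℂ A) :
    inner ℂ x y = ∑ a, star (x a) * y a := by
  simp [PiLp.inner_apply, mul_comm]

theorem norm_sq_sum_smul {E ι : Type*} [NormedAddCommGroup E] [InnerProductSpace ℂ E] [Fintype ι]
    {v : ι → E} (hv : Orthonormal ℂ v) (c : ι → ℂ) :
    ‖∑ i, c i • v i‖ ^ 2 = ∑ i, ‖c i‖ ^ 2 := by
  have h := hv.inner_sum c c Finset.univ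
  rw [inner_self_eq_norm_sq_to_K] at h
  simp only [Complex.conj_mul'] at h
  exact Complex.ofReal_injective (by push_cast; exact h)

/-- If two bilinear expansions of a vector agree and the right factors of one of them are
orthonormal, then its left factors are obtained by pairing. -/
theorem left_factor_eq {A B ι κ : Type*} [Fintype A] [Fintype B] [Fintype ι] [Fintype κ]
    {x : κ → EuclideanSpace ℂ A} {y : κ → EuclideanSpace ℂ B} {w : ι → EuclideanSpace ℂ A}
    {v : ι → EuclideanSpace ℂ B} (hv : Orthonormal ℂ v)
    (h : ∀ a b, ∑ k, x k a * y k b = ∑ i, w i a * v i b) (i : ι) :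
    w i = ∑ k, inner ℂ (v i) (y k) • x k := by
  classical
  ext a
  have h1 : ∑ b, star (v i b) * ∑ k, x k a * y k b = ∑ b, star (v i b) * ∑ j, w j a * v j b := by
    simp only [h]
  have h2 : ∑ b, star (v i b) * ∑ j, w j a * v j b = w i a := by
    simp only [Finset.mul_sum]
    rw [Finset.sum_comm]
    have : ∀ j, ∑ b, star (v i b) * (w j a * v j b) = w j a * inner ℂ (v i) (v j) := by
      intro j
      rw [inner_euclidean, Finset.mul_sum]
      exact Finset.sum_congr rfl fun b _ => by ring
    simp only [this, orthonormal_iff_ite.1 hv]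
    simp
  rw [← h2, ← h1]
  simp only [Finset.mul_sum]
  rw [Finset.sum_comm]
  simp only [WithLp.ofLp_sum, Finset.sum_apply, PiLp.smul_apply, smul_eq_mul, inner_euclidean,
    Finset.sum_mul]
  exact Finset.sum_congr rfl fun k _ => Finset.sum_congr rfl fun b _ => by ring

theorem SchmidtForm.swap {A B ι : Type*} [Fintype A] [Fintype B] [Fintype ι] {χ : A × B → ℂ}
    {l : ι → ℝ} (h : SchmidtForm χ l) : SchmidtForm (fun x : B × A => χ x.swap) l := by
  obtain ⟨h0, u, v, hu, hv, h⟩ := h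
  exact ⟨h0, v, u, hv, hu, fun a b => by simp [h, mul_comm]⟩

/-- The phase of `c` goes into the left vectors, and its modulus enters squared because the
coefficients are squared amplitudes. -/
theorem SchmidtForm.smul {A B ι : Type*} [Fintype A] [Fintype B] [Fintype ι] {χ : A × B → ℂ}
    {l : ι → ℝ} (h : SchmidtForm χ l) (c : ℂ) :
    SchmidtForm (c • χ) (fun i => ‖c‖ ^ 2 * l i) := by
  obtain ⟨h0, u, v, hu, hv, h⟩ := h
  obtain ⟨ω, hω, hc⟩ : ∃ ω : ℂ, ‖ω‖ = 1 ∧ c = ‖c‖ * ω := by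
    by_cases hc : c = 0
    · exact ⟨1, by simp, by simp [hc]⟩
    · have : ‖c‖ ≠ 0 := norm_ne_zero_iff.2 hc
      refine ⟨c / ‖c‖, by simp [this], ?_⟩
      rw [mul_div_cancel₀]
      exact_mod_cast this
  refine ⟨fun i => mul_nonneg (sq_nonneg _) (h0 i), fun i => ω • u i, v, ?_, hv, fun a b => ?_⟩
  · classical
    rw [orthonormal_iff_ite] at hu ⊢
    intro i j
    rw [inner_smul_left, inner_smul_right, hu, ← mul_assoc, Complex.conj_mul', hω]
    simp
  · simp only [Pi.smul_apply, smul_eq_mul, h, Finset.mul_sum]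
    refine Finset.sum_congr rfl fun i _ => ?_
    rw [Real.sqrt_mul (sq_nonneg _), Real.sqrt_sq (norm_nonneg c)]
    conv_lhs => rw [hc]
    simp only [PiLp.smul_apply, smul_eq_mul]
    push_cast
    ring

/-- Every bipartite vector has a Schmidt decomposition. -/
theorem exists_schmidtForm {A B : Type} [Fintype A] [Fintype B] (χ : A × B → ℂ) :
    ∃ (ι : Type) (_ : Fintype ι) (l : ι → ℝ), SchmidtForm χ l := by
  classical
  let M : Matrix A B ℂ := Matrix.of fun a b => χ (a, b)
  have hM : (M.conjTranspose * M).IsHermitian := Matrix.isHermitian_conjTranspose_mul_self M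
  let e := hM.eigenvectorBasis
  let t := hM.eigenvalues
  -- Singular value decomposition: the images of the eigenvectors of `M* M` are orthogonal, with the
  -- eigenvalues as squared norms. Zero eigenvalues are dropped below, since their images cannot be
  -- normalised.
  let w : B → EuclideanSpace ℂ A := fun i => WithLp.toLp 2 (M.mulVec (e i))
  have hw : ∀ i j, inner ℂ (w i) (w j) = if i = j then (t i : ℂ) else 0 := by
    intro i j
    have h1 : inner ℂ (w i) (w j) = inner ℂ (e i)
        (WithLp.toLp 2 ((M.conjTranspose * M).mulVec (e j))) := by
      rw [EuclideanSpace.inner_eq_star_dotProduct, EuclideanSpace.inner_eq_star_dotProduct]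
      simp only [w]
      rw [← Matrix.mulVec_mulVec, Matrix.star_mulVec, dotProduct_comm,
        ← Matrix.dotProduct_mulVec, dotProduct_comm]
    rw [h1, hM.mulVec_eigenvectorBasis]
    have h2 : (WithLp.toLp 2 (hM.eigenvalues j • ⇑(hM.eigenvectorBasis j)) : EuclideanSpace ℂ B)
        = (t j : ℂ) • e j := by
      ext b; simp [t, e]
    rw [h2, inner_smul_right, orthonormal_iff_ite.1 e.orthonormal]
    split_ifs with hij <;> simp [hij]
  have hnorm : ∀ i, ‖w i‖ ^ 2 = t i := by
    intro i
    have := hw i i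
    rw [inner_self_eq_norm_sq_to_K, if_pos rfl] at this
    exact Complex.ofReal_injective (by push_cast; exact this)
  have ht : ∀ i, 0 ≤ t i := fun i => hnorm i ▸ sq_nonneg _
  refine ⟨{i : B // t i ≠ 0}, inferInstance, fun i => t i, fun i => ht i,
    fun i => ((Real.sqrt (t i) : ℂ)⁻¹) • w i, fun i => WithLp.toLp 2 (star (e i)), ?_, ?_, ?_⟩
  · rw [orthonormal_iff_ite]
    rintro ⟨i, hi⟩ ⟨j, hj⟩
    simp only [inner_smul_left, inner_smul_right, hw, Subtype.mk.injEq]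
    split_ifs with hij
    · subst hij
      have : ((Real.sqrt (t i) : ℝ) : ℂ) * (Real.sqrt (t i) : ℝ) = t i := by
        rw [← Complex.ofReal_mul, Real.mul_self_sqrt (ht i)]
      have h0 : ((Real.sqrt (t i) : ℝ) : ℂ) ≠ 0 := by
        exact_mod_cast (Real.sqrt_pos.2 (lt_of_le_of_ne (ht i) (Ne.symm hi))).ne'
      rw [← this, map_inv₀, Complex.conj_ofReal]
      field_simp
    · simp
  · rw [orthonormal_iff_ite]
    rintro ⟨i, hi⟩ ⟨j, hj⟩
    have := orthonormal_iff_ite.1 e.orthonormal j i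
    rw [inner_euclidean] at this ⊢
    simp only [Pi.star_apply, star_star, Subtype.mk.injEq]
    rw [show (if i = j then (1 : ℂ) else 0) = if j = i then 1 else 0 by simp [eq_comm], ← this]
    exact Finset.sum_congr rfl fun b _ => mul_comm _ _
  · intro a b
    have hexp : χ (a, b) = ∑ i, w i a * star (e i b) := by
      have h1 := e.sum_repr (EuclideanSpace.single b (1 : ℂ))
      have h2 : ∀ b', ∑ i, star (e i b) * e i b' = if b' = b then 1 else 0 := by
        intro b'
        have := congrArg (fun x : EuclideanSpace ℂ B => x b') h1
        simp only [e.repr_apply_apply, WithLp.ofLp_sum, Finset.sum_apply, PiLp.smul_apply,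
          smul_eq_mul, inner_euclidean] at this
        simpa [Pi.single_apply] using this
      have h3 : ∀ i, w i a = ∑ b', χ (a, b') * e i b' := fun i => rfl
      simp only [h3, Finset.sum_mul]
      rw [Finset.sum_comm]
      have : ∀ b', ∑ i, χ (a, b') * e i b' * star (e i b) = χ (a, b') * if b' = b then 1 else 0 := by
        intro b'
        rw [← h2, Finset.mul_sum]
        exact Finset.sum_congr rfl fun i _ => by ring
      simp only [this]
      simp
    rw [hexp]
    have hterm : ∀ i, w i a * star (e i b) = ((Real.sqrt (t i) : ℝ) : ℂ) *
        (((Real.sqrt (t i) : ℂ)⁻¹ * w i a) * star (e i b)) := by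
      intro i
      by_cases hi : t i = 0
      · have : w i = 0 := by
          have := hnorm i
          rw [hi] at this
          exact norm_eq_zero.1 (pow_eq_zero_iff (two_ne_zero) |>.1 this)
        simp [this]
      · have h0 : ((Real.sqrt (t i) : ℝ) : ℂ) ≠ 0 := by
          exact_mod_cast (Real.sqrt_pos.2 (lt_of_le_of_ne (ht i) (Ne.symm hi))).ne'
        field_simp
    rw [Finset.sum_congr rfl fun i _ => hterm i,
      ← Finset.sum_filter_of_ne (p := fun i => t i ≠ 0)
        (fun i _ h hi => h (by simp [hi])),
      Finset.sum_subtype (p := fun i => t i ≠ 0) _ (by simp)]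
    rfl

/-! ### Local operators and the Schmidt quasi-norms -/

/-- The operator `K` of the first party applied to a bipartite vector. -/
def applyA {A A' B : Type*} [Fintype A] (K : Matrix A' A ℂ) (χ : A × B → ℂ) : A' × B → ℂ :=
  fun x => ∑ a, K x.1 a * χ (a, x.2)

/-- The operator `K` of the second party applied to a bipartite vector. -/
def applyB {A B B' : Type*} [Fintype B] (K : Matrix B' B ℂ) (χ : A × B → ℂ) : A × B' → ℂ :=
  fun x => ∑ b, K x.2 b * χ (x.1, b)

/-- The numbers `l i * ‖K u i‖ ^ 2` are the diagonal entries, along `v`, of the second party's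
reduced state of `K χ`, and `m` lists its eigenvalues. Each diagonal entry is thus a sub-convex
combination of eigenvalues, and concavity of `x ↦ x ^ α` applies as in Schur's theorem. -/
theorem sum_rpow_le_of_schmidtForm_applyA {A A' B ι κ : Type*} [Fintype A] [Fintype A'] [Fintype B]
    [Fintype ι] [Fintype κ] {α : ℝ} (hα : 0 < α) (hα1 : α < 1) {χ : A × B → ℂ} {l : ι → ℝ}
    (hl : ∀ i, 0 ≤ l i) {u : ι → EuclideanSpace ℂ A} {v : ι → EuclideanSpace ℂ B}
    (hv : Orthonormal ℂ v)
    (hχ : ∀ a b, χ (a, b) = ∑ i, ((Real.sqrt (l i) : ℝ) : ℂ) * (u i a * v i b))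
    (K : Matrix A' A ℂ) {m : κ → ℝ} (hm : SchmidtForm (applyA K χ) m) :
    ∑ k, m k ^ α ≤
      ∑ i, (l i * ‖(WithLp.toLp 2 (K.mulVec (u i)) : EuclideanSpace ℂ A')‖ ^ 2) ^ α := by
  obtain ⟨hm0, x, y, hx, hy, hm⟩ := hm
  let w : ι → EuclideanSpace ℂ A' := fun i => WithLp.toLp 2 (K.mulVec (u i))
  have key : ∀ a b, ∑ k, ((Real.sqrt (m k) : ℂ) • x k) a * y k b =
      ∑ i, ((Real.sqrt (l i) : ℂ) • w i) a * v i b := by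
    intro a b
    have h1 := hm a b
    simp only [applyA, hχ, Finset.mul_sum] at h1
    rw [Finset.sum_comm] at h1
    simp only [PiLp.smul_apply, smul_eq_mul, mul_assoc]
    rw [← h1]
    refine Finset.sum_congr rfl fun i _ => ?_
    simp only [w, Matrix.mulVec, dotProduct, Finset.sum_mul, Finset.mul_sum]
    exact Finset.sum_congr rfl fun a _ => by ring
  have h1 : ∀ i, l i * ‖w i‖ ^ 2 = ∑ k, ‖inner ℂ (v i) (y k)‖ ^ 2 * m k := by
    intro i
    have h := congrArg (fun z => ‖z‖ ^ 2) (left_factor_eq hv key i)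
    simp only [smul_smul] at h
    rw [norm_sq_sum_smul hx] at h
    simpa [norm_smul, mul_pow, Real.sq_sqrt (hl _), Real.sq_sqrt (hm0 _),
      abs_of_nonneg (Real.sqrt_nonneg _)] using h
  -- For `m k ≠ 0` the vector `y k` lies in the span of `v`, so Bessel's inequality is an equality;
  -- pairing with `x k` from the other side shows this.
  have h2 : ∀ k, m k ≠ 0 → ∑ i, ‖inner ℂ (v i) (y k)‖ ^ 2 = 1 := by
    intro k hk
    have key' : ∀ b a, ∑ i, v i b * ((Real.sqrt (l i) : ℂ) • w i) a =
        ∑ k, ((Real.sqrt (m k) : ℂ) • y k) b * x k a := by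
      intro b a
      rw [Finset.sum_congr rfl fun i _ => mul_comm (v i b) _, ← key]
      exact Finset.sum_congr rfl fun k _ => by simp only [PiLp.smul_apply, smul_eq_mul]; ring
    have hk' := left_factor_eq hx key' k
    have hc : ∀ i, inner ℂ (x k) ((Real.sqrt (l i) : ℂ) • w i) =
        (Real.sqrt (m k) : ℂ) * inner ℂ (v i) (y k) := by
      classical
      intro i
      rw [← inner_smul_right, hk', inner_sum]
      simp [inner_smul_right, orthonormal_iff_ite.1 hv]
    have h := congrArg (fun z => ‖z‖ ^ 2) hk'
    simp only [hc] at h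
    rw [norm_sq_sum_smul hv] at h
    simp only [norm_smul, mul_pow, Complex.norm_real, norm_mul, Real.norm_eq_abs, sq_abs,
      Real.sq_sqrt (hm0 k), hy.1 k, mul_one, ← Finset.mul_sum] at h
    exact mul_left_cancel₀ hk (h.symm.trans (mul_one _).symm)
  have h3 : ∀ i, ∑ k, ‖inner ℂ (v i) (y k)‖ ^ 2 ≤ 1 := by
    intro i
    have := hy.sum_inner_products_le (v i) (s := Finset.univ)
    simpa [norm_inner_symm, hv.1 i] using this
  calc ∑ k, m k ^ α = ∑ k, ∑ i, ‖inner ℂ (v i) (y k)‖ ^ 2 * m k ^ α := by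
        refine Finset.sum_congr rfl fun k _ => ?_
        rw [← Finset.sum_mul]
        by_cases hk : m k = 0
        · simp [hk, Real.zero_rpow hα.ne']
        · rw [h2 k hk, one_mul]
    _ = ∑ i, ∑ k, ‖inner ℂ (v i) (y k)‖ ^ 2 * m k ^ α := Finset.sum_comm
    _ ≤ ∑ i, (∑ k, ‖inner ℂ (v i) (y k)‖ ^ 2 * m k) ^ α :=
        Finset.sum_le_sum fun i _ => sum_mul_rpow_le_rpow_sum hα hα1 (fun _ => sq_nonneg _) hm0 (h3 i)
    _ = ∑ i, (l i * ‖w i‖ ^ 2) ^ α := by simp only [h1]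

/-- The power sum of the Schmidt coefficients does not depend on the Schmidt decomposition. -/
theorem SchmidtForm.sum_rpow_le {A B ι κ : Type*} [Fintype A] [Fintype B] [Fintype ι] [Fintype κ]
    {α : ℝ} (hα : 0 < α) (hα1 : α < 1) {χ : A × B → ℂ} {l : ι → ℝ} {m : κ → ℝ}
    (hl : SchmidtForm χ l) (hm : SchmidtForm χ m) : ∑ k, m k ^ α ≤ ∑ i, l i ^ α := by
  classical
  obtain ⟨h0, u, v, hu, hv, h⟩ := hl
  have h1 : applyA (1 : Matrix A A ℂ) χ = χ := by
    ext x; simp [applyA, Matrix.one_apply]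
  refine (sum_rpow_le_of_schmidtForm_applyA hα hα1 h0 hv h 1 (by rwa [h1])).trans_eq ?_
  simp [hu.1]

/-- The quasi-norm `(∑ i, l i ^ α) ^ (1 / α)` of the Schmidt coefficients of a bipartite vector. -/
noncomputable def schmidtNorm {A B : Type} [Fintype A] [Fintype B] (α : ℝ) (χ : A × B → ℂ) : ℝ :=
  sInf {x | ∃ (ι : Type) (_ : Fintype ι) (l : ι → ℝ), SchmidtForm χ l ∧
    x = (∑ i, l i ^ α) ^ (1 / α)}

/-- All Schmidt decompositions share the same power sum, so the infimum in the definition is over a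
single point. -/
theorem SchmidtForm.schmidtNorm_eq {A B ι : Type} [Fintype A] [Fintype B] [Fintype ι]
    {α : ℝ} (hα : 0 < α) (hα1 : α < 1) {χ : A × B → ℂ} {l : ι → ℝ} (h : SchmidtForm χ l) :
    schmidtNorm α χ = (∑ i, l i ^ α) ^ (1 / α) := by
  have : {x | ∃ (ι : Type) (_ : Fintype ι) (l : ι → ℝ), SchmidtForm χ l ∧
      x = (∑ i, l i ^ α) ^ (1 / α)} = {(∑ i, l i ^ α) ^ (1 / α)} := by
    ext x
    constructor
    · rintro ⟨κ, _, m, hm, rfl⟩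
      rw [Set.mem_singleton_iff, (h.sum_rpow_le hα hα1 hm).antisymm (hm.sum_rpow_le hα hα1 h)]
    · rintro rfl
      exact ⟨ι, _, l, h, rfl⟩
  rw [schmidtNorm, this, csInf_singleton]

theorem schmidtNorm_swap {A B : Type} [Fintype A] [Fintype B] {α : ℝ} (hα : 0 < α) (hα1 : α < 1)
    (χ : A × B → ℂ) : schmidtNorm α (fun x : B × A => χ x.swap) = schmidtNorm α χ := by
  obtain ⟨ι, _, l, h⟩ := exists_schmidtForm χ
  rw [h.schmidtNorm_eq hα hα1, h.swap.schmidtNorm_eq hα hα1]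

theorem schmidtNorm_smul {A B : Type} [Fintype A] [Fintype B] {α : ℝ} (hα : 0 < α) (hα1 : α < 1)
    (c : ℂ) (χ : A × B → ℂ) : schmidtNorm α (c • χ) = ‖c‖ ^ 2 * schmidtNorm α χ := by
  obtain ⟨ι, _, l, h⟩ := exists_schmidtForm χ
  rw [h.schmidtNorm_eq hα hα1, (h.smul c).schmidtNorm_eq hα hα1]
  simp only [Real.mul_rpow (sq_nonneg ‖c‖) (h.1 _), ← Finset.mul_sum]
  rw [Real.mul_rpow (Real.rpow_nonneg (sq_nonneg _) _)
    (Finset.sum_nonneg fun i _ => Real.rpow_nonneg (h.1 i) _),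
    ← Real.rpow_mul (sq_nonneg _), mul_one_div_cancel hα.ne', Real.rpow_one]

theorem sum_norm_mulVec_sq_le {A A' J : Type*} [Fintype A] [Fintype A'] [DecidableEq A]
    (K : J → Matrix A' A ℂ) (s : Finset J)
    (hK : (1 - ∑ j ∈ s, (K j).conjTranspose * K j).PosSemidef) (x : EuclideanSpace ℂ A) :
    ∑ j ∈ s, ‖(WithLp.toLp 2 ((K j).mulVec x) : EuclideanSpace ℂ A')‖ ^ 2 ≤ ‖x‖ ^ 2 := by
  have h := hK.dotProduct_mulVec_nonneg x
  rw [Matrix.sub_mulVec, Matrix.one_mulVec, Matrix.sum_mulVec, dotProduct_sub,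
    dotProduct_sum] at h
  have h1 : ∀ j, star (x : A → ℂ) ⬝ᵥ ((K j).conjTranspose * K j).mulVec x =
      ((‖(WithLp.toLp 2 ((K j).mulVec x) : EuclideanSpace ℂ A')‖ ^ 2 : ℝ) : ℂ) := by
    intro j
    rw [← Matrix.mulVec_mulVec, Matrix.dotProduct_mulVec, ← Matrix.star_mulVec,
      EuclideanSpace.norm_sq_eq]
    simp [dotProduct, Complex.conj_mul']
  have h2 : star (x : A → ℂ) ⬝ᵥ (x : A → ℂ) = ((‖x‖ ^ 2 : ℝ) : ℂ) := by
    rw [EuclideanSpace.norm_sq_eq]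
    simp [dotProduct, Complex.conj_mul']
  simp only [h1, h2] at h
  rw [← Complex.ofReal_sum, ← Complex.ofReal_sub, Complex.zero_le_real] at h
  linarith

/-- Superadditivity of the quasi-norms under measurements of the first party. -/
theorem sum_schmidtNorm_applyA_le {A A' B J : Type} [Fintype A] [Fintype A'] [Fintype B]
    [DecidableEq A] {α : ℝ} (hα : 0 < α) (hα1 : α < 1) (χ : A × B → ℂ)
    (K : J → Matrix A' A ℂ) (s : Finset J)
    (hK : (1 - ∑ j ∈ s, (K j).conjTranspose * K j).PosSemidef) :
    ∑ j ∈ s, schmidtNorm α (applyA (K j) χ) ≤ schmidtNorm α χ := by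
  obtain ⟨ι, _, l, h⟩ := exists_schmidtForm χ
  rw [h.schmidtNorm_eq hα hα1]
  obtain ⟨hl, u, v, hu, hv, h⟩ := h
  -- The weight that outcome `j` leaves on the `i`-th Schmidt term; by the Kraus bound at the unit
  -- vector `u i` these add up over `j` to at most `l i`.
  let d : s → ι → ℝ := fun j i =>
    l i * ‖(WithLp.toLp 2 ((K j).mulVec (u i)) : EuclideanSpace ℂ A')‖ ^ 2
  have hd : ∀ j i, 0 ≤ d j i := fun j i => mul_nonneg (hl i) (sq_nonneg _)
  calc ∑ j ∈ s, schmidtNorm α (applyA (K j) χ)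
      = ∑ j : s, schmidtNorm α (applyA (K j) χ) := (Finset.sum_coe_sort s _).symm
    _ ≤ ∑ j : s, (∑ i, d j i ^ α) ^ (1 / α) := by
        refine Finset.sum_le_sum fun j _ => ?_
        obtain ⟨κ, _, m, hm⟩ := exists_schmidtForm (applyA (K j) χ)
        rw [hm.schmidtNorm_eq hα hα1]
        exact Real.rpow_le_rpow (Finset.sum_nonneg fun k _ => Real.rpow_nonneg (hm.1 k) _)
          (sum_rpow_le_of_schmidtForm_applyA hα hα1 hl hv h (K j) hm) (one_div_nonneg.2 hα.le)
    _ ≤ (∑ i, (∑ j, d j i) ^ α) ^ (1 / α) := sum_rpow_sum_rpow_le hα hα1 hd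
    _ ≤ (∑ i, l i ^ α) ^ (1 / α) := by
        refine Real.rpow_le_rpow (Finset.sum_nonneg fun i _ => Real.rpow_nonneg
          (Finset.sum_nonneg fun j _ => hd j i) _) (Finset.sum_le_sum fun i _ => ?_)
          (one_div_nonneg.2 hα.le)
        refine Real.rpow_le_rpow (Finset.sum_nonneg fun j _ => hd j i) ?_ hα.le
        simp only [d, ← Finset.mul_sum]
        refine mul_le_of_le_one_right (hl i) ?_
        rw [Finset.sum_coe_sort s (fun j =>
          ‖(WithLp.toLp 2 ((K j).mulVec (u i)) : EuclideanSpace ℂ A')‖ ^ 2)]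
        simpa [hu.1 i] using sum_norm_mulVec_sq_le K s hK (u i)

/-- Superadditivity of the quasi-norms under measurements of the second party. -/
theorem sum_schmidtNorm_applyB_le {A B B' J : Type} [Fintype A] [Fintype B] [Fintype B']
    [DecidableEq B] {α : ℝ} (hα : 0 < α) (hα1 : α < 1) (χ : A × B → ℂ)
    (K : J → Matrix B' B ℂ) (s : Finset J)
    (hK : (1 - ∑ j ∈ s, (K j).conjTranspose * K j).PosSemidef) :
    ∑ j ∈ s, schmidtNorm α (applyB (K j) χ) ≤ schmidtNorm α χ := by
  rw [← schmidtNorm_swap hα hα1 χ]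
  refine le_trans (Finset.sum_le_sum fun j _ => ?_)
    (sum_schmidtNorm_applyA_le hα hα1 (fun x : B × A => χ x.swap) K s hK)
  rw [← schmidtNorm_swap hα hα1]
  exact le_of_eq rfl

/-! ### Monotonicity of the quasi-norms under LOCC channels -/

/-- `ρ` is a mixture of unnormalised pure states whose quasi-norms add up to at most `c`. -/
def HasDecomposition (α : ℝ) {A B X : Type} [Fintype A] [Fintype B] [DecidableEq X]
    (ρ : X → Matrix (A × B) (A × B) ℂ) (c : ℝ) : Prop :=
  ∃ (T : Type) (_ : Fintype T) (y : T → X) (χ : T → A × B → ℂ),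
    (∀ x, ρ x = ∑ t with y t = x, Matrix.vecMulVec (χ t) (star (χ t))) ∧
      ∑ t, schmidtNorm α (χ t) ≤ c

theorem kronecker_one_mulVec {A A' B : Type} [Fintype A] [Fintype B] [DecidableEq B]
    (K : Matrix A' A ℂ) (χ : A × B → ℂ) :
    (K ⊗ₖ (1 : Matrix B B ℂ)).mulVec χ = applyA K χ := by
  ext ⟨a, b⟩
  simp [Matrix.mulVec, dotProduct, applyA, Fintype.sum_prod_type, Matrix.one_apply]

theorem one_kronecker_mulVec {A B B' : Type} [Fintype A] [Fintype B] [DecidableEq A]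
    (K : Matrix B' B ℂ) (χ : A × B → ℂ) :
    ((1 : Matrix A A ℂ) ⊗ₖ K).mulVec χ = applyB K χ := by
  ext ⟨a, b⟩
  simp [Matrix.mulVec, dotProduct, applyB, Fintype.sum_prod_type, Matrix.one_apply]

theorem conj_vecMulVec {m n : Type*} [Fintype n] (M : Matrix m n ℂ) (χ : n → ℂ) :
    M * Matrix.vecMulVec χ (star χ) * M.conjTranspose =
      Matrix.vecMulVec (M.mulVec χ) (star (M.mulVec χ)) := by
  rw [Matrix.mul_vecMulVec, Matrix.vecMulVec_mul, Matrix.star_mulVec]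

/-- A step that acts on each pure component by operators `F j`, for which the quasi-norm is
superadditive, preserves decompositions. -/
theorem HasDecomposition.step {α : ℝ} {A B X A' B' Y J : Type} [Fintype A] [Fintype B]
    [DecidableEq X] [Fintype A'] [Fintype B'] [DecidableEq Y] [Fintype J]
    {ρ : X → Matrix (A × B) (A × B) ℂ} {c : ℝ} (h : HasDecomposition α ρ c)
    (F : J → Matrix (A' × B') (A × B) ℂ) (f : J → X) (g : J → Y)
    (hF : ∀ x χ, ∑ j with f j = x, schmidtNorm α ((F j).mulVec χ) ≤ schmidtNorm α χ) :
    HasDecomposition α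
      (fun y => ∑ j with g j = y, F j * ρ (f j) * (F j).conjTranspose) c := by
  classical
  obtain ⟨T, _, y, χ, hρ, hc⟩ := h
  -- Component `t` is met only by the operators whose register label agrees with `y t`, so the new
  -- components are the matching pairs.
  refine ⟨{p : T × J // f p.2 = y p.1}, inferInstance, fun p => g p.1.2,
    fun p => (F p.1.2).mulVec (χ p.1.1), fun z => ?_, le_trans ?_ hc⟩
  · simp only [hρ, Matrix.mul_sum, Matrix.sum_mul, conj_vecMulVec]
    rw [Finset.sum_filter, Finset.sum_filter, ← Finset.sum_subtype (p := fun p : T × J => f p.2 = y p.1)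
      (Finset.univ.filter fun p => f p.2 = y p.1) (by simp)
      (fun p => if g p.2 = z then Matrix.vecMulVec ((F p.2).mulVec (χ p.1))
        (star ((F p.2).mulVec (χ p.1))) else 0), Finset.sum_filter,
      Fintype.sum_prod_type, Finset.sum_comm]
    refine Finset.sum_congr rfl fun j _ => ?_
    split_ifs with hj
    · rw [Finset.sum_filter]
      exact Finset.sum_congr rfl fun t _ => by simp only [eq_comm]
    · simp
  · rw [← Finset.sum_subtype (p := fun p : T × J => f p.2 = y p.1)
      (Finset.univ.filter fun p => f p.2 = y p.1) (by simp)
      (fun p => schmidtNorm α ((F p.2).mulVec (χ p.1))), Finset.sum_filter,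
      Fintype.sum_prod_type]
    refine Finset.sum_le_sum fun t _ => ?_
    rw [← Finset.sum_filter]
    exact hF (y t) (χ t)

/-- Rewriting the register may merge outcomes into mixed states; following an ensemble keeps each
component pure, so the superadditivity for vectors suffices. -/
theorem IsLOCC.hasDecomposition {α : ℝ} (hα : 0 < α) (hα1 : α < 1) {S T : StateSpace}
    {Λ : S.Op → T.Op} (hΛ : IsLOCC S T Λ) {ρ : S.Op} {c : ℝ} (h : HasDecomposition α ρ c) :
    HasDecomposition α (Λ ρ) c := by
  induction hΛ with
  | refl => exact h
  | stepA _ A' Y J K f g hK ih =>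
    refine ih.step (fun j => K j ⊗ₖ 1) f g fun x χ => ?_
    simp only [kronecker_one_mulVec]
    exact sum_schmidtNorm_applyA_le hα hα1 χ K _ (hK x)
  | stepB _ B' Y J K f g hK ih =>
    refine ih.step (fun j => 1 ⊗ₖ K j) f g fun x χ => ?_
    simp only [one_kronecker_mulVec]
    exact sum_schmidtNorm_applyB_le hα hα1 χ K _ (hK x)

/-- A decomposition of a pure state consists of multiples of this state. -/
theorem exists_smul_of_sum_vecMulVec {n T : Type*} [Fintype n] [Fintype T] {φ : n → ℂ}
    (hφ : star φ ⬝ᵥ φ = 1) {χ : T → n → ℂ}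
    (h : Matrix.vecMulVec φ (star φ) = ∑ t, Matrix.vecMulVec (χ t) (star (χ t))) :
    ∃ c : T → ℂ, (∀ t, χ t = c t • φ) ∧ ∑ t, ‖c t‖ ^ 2 = 1 := by
  have hq : ∀ z χ : n → ℂ, star z ⬝ᵥ (Matrix.vecMulVec χ (star χ)).mulVec z =
      ((‖star χ ⬝ᵥ z‖ ^ 2 : ℝ) : ℂ) := by
    intro z χ
    rw [Matrix.vecMulVec_mulVec, dotProduct_smul]
    have : star z ⬝ᵥ χ = star (star χ ⬝ᵥ z) := by rw [Matrix.star_dotProduct]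
    simp only [this, MulOpposite.smul_eq_mul_unop, MulOpposite.unop_op]
    rw [Complex.ofReal_pow, ← Complex.conj_mul']
    rfl
  have hsum : ∀ z, ‖star φ ⬝ᵥ z‖ ^ 2 = ∑ t, ‖star (χ t) ⬝ᵥ z‖ ^ 2 := by
    intro z
    have := congrArg (fun M => star z ⬝ᵥ Matrix.mulVec M z) h
    simp only [Matrix.sum_mulVec, dotProduct_sum, hq] at this
    exact_mod_cast this
  refine ⟨fun t => star φ ⬝ᵥ χ t, fun t => ?_, ?_⟩
  -- The part of `χ t` orthogonal to `φ`. The quadratic form of `|φ⟩⟨φ|` vanishes on it, hence so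
  -- does each nonnegative summand.
  · let z := χ t - (star φ ⬝ᵥ χ t) • φ
    have hz : star φ ⬝ᵥ z = 0 := by
      simp [z, dotProduct_sub, dotProduct_smul, hφ]
    have h1 := hsum z
    rw [hz, norm_zero, zero_pow two_ne_zero] at h1
    have h2 := (Finset.sum_eq_zero_iff_of_nonneg (fun t _ => sq_nonneg _)).1 h1.symm t
      (Finset.mem_univ t)
    have h3 : star (χ t) ⬝ᵥ z = 0 := norm_eq_zero.1 (pow_eq_zero_iff two_ne_zero |>.1 h2)
    have h4 : star z ⬝ᵥ z = 0 := by
      have : star z = star (χ t) - star (star φ ⬝ᵥ χ t) • star φ := by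
        simp [z]
      rw [this, sub_dotProduct, smul_dotProduct, h3, hz, smul_zero, sub_zero]
    exact sub_eq_zero.1 (dotProduct_star_self_eq_zero.1 h4)
  · have h1 := hsum φ
    rw [hφ, norm_one, one_pow] at h1
    rw [h1]
    refine Finset.sum_congr rfl fun t _ => ?_
    have : star φ ⬝ᵥ χ t = star (star (χ t) ⬝ᵥ φ) := by rw [Matrix.star_dotProduct]
    simp only [this, norm_star]

/-- The final components are `c t • φ` with `∑ ‖c t‖ ^ 2 = 1`, so their quasi-norms add up to
exactly that of `φ`. -/
theorem schmidtNorm_le_of_convertible {A B C D : Type} [Fintype A] [Fintype B] [Fintype C]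
    [Fintype D] [DecidableEq A] [DecidableEq B] [DecidableEq C] [DecidableEq D] {α : ℝ}
    (hα : 0 < α) (hα1 : α < 1) {ψ : A × B → ℂ} {φ : C × D → ℂ} (hφ : star φ ⬝ᵥ φ = 1)
    (h : LOCCConvertible ψ φ) : schmidtNorm α φ ≤ schmidtNorm α ψ := by
  obtain ⟨Λ, hΛ, h⟩ := h
  have h0 : HasDecomposition α (X := Unit) (pureState ψ) (schmidtNorm α ψ) :=
    ⟨Unit, inferInstance, id, fun _ => ψ, fun x => by simp [pureState], by simp⟩
  obtain ⟨T, _, y, χ, h1, h2⟩ := hΛ.hasDecomposition hα hα1 h0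
  have h3 := h1 ()
  rw [h] at h3
  simp only [Finset.filter_true] at h3
  obtain ⟨c, hc, hc1⟩ := exists_smul_of_sum_vecMulVec hφ h3
  simpa [hc, schmidtNorm_smul hα hα1, ← Finset.sum_mul, hc1] using h2

/-! ### Tensor powers -/

theorem SchmidtForm.tensorPow {A B ι : Type} [Fintype A] [Fintype B] [Fintype ι] {ψ : A × B → ℂ}
    {l : ι → ℝ} (h : SchmidtForm ψ l) (n : ℕ) :
    SchmidtForm (tensorPow ψ n) (fun x : Fin n → ι => ∏ t, l (x t)) := by
  classical
  have horth : ∀ {A : Type} [Fintype A] {u : ι → EuclideanSpace ℂ A}, Orthonormal ℂ u →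
      Orthonormal ℂ (fun x : Fin n → ι =>
        (WithLp.toLp 2 fun a : Fin n → A => ∏ t, u (x t) (a t) :
          EuclideanSpace ℂ (Fin n → A))) := by
    intro A _ u hu
    rw [orthonormal_iff_ite] at hu ⊢
    intro x y
    simp only [inner_euclidean, star_prod, ← Finset.prod_mul_distrib] at hu ⊢
    rw [← Fintype.piFinset_univ,
      ← Finset.prod_univ_sum (fun _ => Finset.univ) (fun t a => star (u (x t) a) * u (y t) a)]
    simp only [hu, Finset.prod_ite_zero, Finset.prod_const_one, Finset.mem_univ, forall_true_left,
      funext_iff]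
  obtain ⟨h0, u, v, hu, hv, h⟩ := h
  refine ⟨fun x => Finset.prod_nonneg fun t _ => h0 _, _, _, horth hu, horth hv, fun a b => ?_⟩
  simp only [BipartiteLOCC.tensorPow, h]
  rw [Finset.prod_univ_sum (fun _ => Finset.univ), Fintype.piFinset_univ]
  refine Finset.sum_congr rfl fun x _ => ?_
  rw [Finset.prod_mul_distrib, Finset.prod_mul_distrib, ← Complex.ofReal_prod,
    ← Real.sqrt_prod]
  exact fun t _ => h0 _

theorem SchmidtForm.star_dotProduct_self {A B ι : Type} [Fintype A] [Fintype B] [Fintype ι]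
    {ψ : A × B → ℂ} {l : ι → ℝ} (h : SchmidtForm ψ l) :
    star ψ ⬝ᵥ ψ = ((∑ i, l i : ℝ) : ℂ) := by
  classical
  obtain ⟨h0, u, v, hu, hv, h⟩ := h
  simp only [orthonormal_iff_ite, inner_euclidean] at hu hv
  calc star ψ ⬝ᵥ ψ = ∑ i, ∑ j, (Real.sqrt (l i) : ℂ) * (Real.sqrt (l j) : ℂ) *
        ((∑ a, star (u i a) * u j a) * ∑ b, star (v i b) * v j b) := by
        simp only [dotProduct, Fintype.sum_prod_type, Pi.star_apply, h, star_sum, star_mul',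
          Finset.sum_mul_sum, Complex.star_def, Complex.conj_ofReal]
        simp only [Finset.mul_sum]
        rw [Finset.sum_congr rfl fun a _ => Finset.sum_comm]
        rw [Finset.sum_comm]
        refine Finset.sum_congr rfl fun i _ => ?_
        rw [Finset.sum_congr rfl fun a _ => Finset.sum_comm]
        rw [Finset.sum_comm]
        refine Finset.sum_congr rfl fun j _ => ?_
        refine Finset.sum_congr rfl fun a _ => Finset.sum_congr rfl fun b _ => by ring
    _ = _ := by
        simp only [hu, hv]
        push_cast
        refine Finset.sum_congr rfl fun i _ => ?_
        simp [← Complex.ofReal_mul, Real.mul_self_sqrt (h0 i)]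

theorem sum_prod_eq_pow {ι : Type*} [Fintype ι] (f : ι → ℝ) (n : ℕ) :
    ∑ x : Fin n → ι, ∏ t, f (x t) = (∑ i, f i) ^ n := by
  classical
  rw [← Fintype.piFinset_univ, ← Finset.prod_univ_sum (fun _ => Finset.univ) (fun _ i => f i)]
  simp

/-- The necessary condition for the conversion of tensor powers. -/
theorem pow_le_of_convertible {A B C D ι κ : Type} [Fintype A] [Fintype B] [Fintype C]
    [Fintype D] [DecidableEq A] [DecidableEq B] [DecidableEq C] [DecidableEq D] [Fintype ι]
    [Fintype κ] {ψ : A × B → ℂ} {φ : C × D → ℂ} {p : ι → ℝ} {q : κ → ℝ} (hψ : SchmidtForm ψ p)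
    (hφ : SchmidtForm φ q) (hq : ∑ j, q j = 1) {α : ℝ} (hα : 0 < α) (hα1 : α < 1) {n m : ℕ}
    {c : ℝ} (hc : 0 ≤ c) (h : LOCCConvertible ((c : ℂ) • tensorPow ψ n) (tensorPow φ m)) :
    (∑ j, q j ^ α) ^ m ≤ c ^ (2 * α) * (∑ i, p i ^ α) ^ n := by
  have h1 := schmidtNorm_le_of_convertible hα hα1
    (by rw [(hφ.tensorPow m).star_dotProduct_self, sum_prod_eq_pow, hq]; simp) h
  rw [((hψ.tensorPow n).smul c).schmidtNorm_eq hα hα1, (hφ.tensorPow m).schmidtNorm_eq hα hα1] at h1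
  have hp0 : 0 ≤ (∑ i, p i ^ α) ^ n :=
    pow_nonneg (Finset.sum_nonneg fun i _ => Real.rpow_nonneg (hψ.1 i) _) _
  have hq0 : 0 ≤ (∑ i, q i ^ α) ^ m :=
    pow_nonneg (Finset.sum_nonneg fun i _ => Real.rpow_nonneg (hφ.1 i) _) _
  have h2 : ∑ x : Fin n → ι, (‖(c : ℂ)‖ ^ 2 * ∏ t, p (x t)) ^ α =
      c ^ (2 * α) * (∑ i, p i ^ α) ^ n := by
    rw [← sum_prod_eq_pow, Finset.mul_sum]
    refine Finset.sum_congr rfl fun x _ => ?_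
    rw [Real.mul_rpow (sq_nonneg _) (Finset.prod_nonneg fun t _ => hψ.1 _),
      Real.finsetProd_rpow _ _ fun t _ => hψ.1 _]
    rw [Complex.norm_real, Real.norm_of_nonneg hc, Real.rpow_mul hc, Real.rpow_two]
  have h3 : ∑ x : Fin m → κ, (∏ t, q (x t)) ^ α = (∑ i, q i ^ α) ^ m := by
    rw [← sum_prod_eq_pow]
    exact Finset.sum_congr rfl fun x _ => (Real.finsetProd_rpow _ _ (fun t _ => hφ.1 _) _).symm
  rw [h2, h3] at h1
  exact (Real.rpow_le_rpow_iff hq0 (mul_nonneg (Real.rpow_nonneg hc _) hp0)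
    (one_div_pos.2 hα)).1 h1

/-! ### A sufficient condition for convertibility -/

/-- A nonnegative matrix with column sums `1` and row sums at most `1` is a convex combination of
the matrices of injections. -/
theorem exists_injections_of_substochastic {I J : Type} [Fintype I] [Fintype J] [DecidableEq I]
    {T : I → J → ℝ} (hT : ∀ i j, 0 ≤ T i j) (hcol : ∀ j, ∑ i, T i j = 1)
    (hrow : ∀ i, ∑ j, T i j ≤ 1) :
    ∃ (S : Type) (_ : Fintype S) (w : S → ℝ) (e : S → J ↪ I), (∀ s, 0 ≤ w s) ∧ ∑ s, w s = 1 ∧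
      ∀ i j, T i j = ∑ s, if e s j = i then w s else 0 := by
  have hsum : ∑ i, (1 - ∑ j, T i j) = (Fintype.card I : ℝ) - Fintype.card J := by
    rw [Finset.sum_sub_distrib, Finset.sum_comm]
    simp [hcol]
  have hle : Fintype.card J ≤ Fintype.card I := by
    have : 0 ≤ ∑ i, (1 - ∑ j, T i j) := Finset.sum_nonneg fun i _ => sub_nonneg.2 (hrow i)
    rw [hsum, sub_nonneg] at this
    exact_mod_cast this
  obtain ⟨k, hk⟩ := Nat.exists_eq_add_of_le hle
  have hsum' : ∑ i, (1 - ∑ j, T i j) = k := by rw [hsum, hk]; push_cast; ring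
  let e : J ⊕ Fin k ≃ I := Fintype.equivOfCardEq (by simp [hk])
  -- The row deficits are spread evenly over `k` extra columns, `k` being the total deficit. The
  -- square matrix is doubly stochastic; Birkhoff's permutations restricted to the original columns
  -- are the injections.
  let M : Matrix I I ℝ := Matrix.of fun i i' =>
    Sum.elim (fun j => T i j) (fun _ => (1 - ∑ j, T i j) / k) (e.symm i')
  have hM : M ∈ doublyStochastic ℝ I := by
    rw [mem_doublyStochastic_iff_sum]
    refine ⟨fun i i' => ?_, fun i => ?_, fun i' => ?_⟩
    · simp only [M, Matrix.of_apply]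
      rcases e.symm i' with j | j
      · exact hT i j
      · exact div_nonneg (sub_nonneg.2 (hrow i)) (Nat.cast_nonneg k)
    · simp only [M, Matrix.of_apply]
      rw [← e.sum_comp]
      simp only [Equiv.symm_apply_apply, Fintype.sum_sum_type, Sum.elim_inl, Sum.elim_inr,
        Finset.sum_const, Finset.card_univ, Fintype.card_fin, nsmul_eq_mul]
      rcases Nat.eq_zero_or_pos k with rfl | hk0
      · have := (Finset.sum_eq_zero_iff_of_nonneg
          (fun i _ => sub_nonneg.2 (hrow i))).1 (by simpa using hsum') i (Finset.mem_univ i)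
        simp only [Nat.cast_zero, zero_mul, add_zero]
        linarith
      · rw [mul_div_cancel₀ _ (by exact_mod_cast hk0.ne')]
        ring
    · simp only [M, Matrix.of_apply]
      rcases e.symm i' with j | j
      · exact hcol j
      · simp only [Sum.elim_inr]
        rw [← Finset.sum_div, hsum', div_self]
        exact_mod_cast (Fin.pos j).ne'
  obtain ⟨w, hw, hw1, hwM⟩ := exists_eq_sum_perm_of_mem_doublyStochastic hM
  refine ⟨Equiv.Perm I, inferInstance, w,
    fun σ => ⟨fun j => σ.symm (e (Sum.inl j)), fun j j' h => by simpa using h⟩, hw, hw1,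
    fun i j => ?_⟩
  have h := congrFun (congrFun hwM i) (e (Sum.inl j))
  simp only [M, Matrix.of_apply, Equiv.symm_apply_apply, Sum.elim_inl] at h
  rw [← h, Matrix.sum_apply]
  refine Finset.sum_congr rfl fun σ _ => ?_
  have hiff : (⟨fun j => σ.symm (e (Sum.inl j)), fun j j' h => by simpa using h⟩ : J ↪ I) j = i ↔
      e (Sum.inl j) = σ i := Equiv.symm_apply_eq σ
  simp only [Matrix.smul_apply, Equiv.Perm.permMatrix, PEquiv.toMatrix_apply, smul_eq_mul,
    Equiv.toPEquiv_apply, Option.mem_some_iff, hiff, eq_comm, mul_ite, mul_one, mul_zero]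

theorem posSemidef_one_sub_of_sum_norm_le {A A' J : Type*} [Fintype A] [Fintype A']
    [DecidableEq A] (K : J → Matrix A' A ℂ) (s : Finset J)
    (h : ∀ x : EuclideanSpace ℂ A,
      ∑ j ∈ s, ‖(WithLp.toLp 2 ((K j).mulVec x) : EuclideanSpace ℂ A')‖ ^ 2 ≤ ‖x‖ ^ 2) :
    (1 - ∑ j ∈ s, (K j).conjTranspose * K j).PosSemidef := by
  refine .of_dotProduct_mulVec_nonneg ?_ fun y => ?_
  · simp [Matrix.IsHermitian, Matrix.conjTranspose_sum]
  · let x : EuclideanSpace ℂ A := WithLp.toLp 2 y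
    have h1 : ∀ j, star y ⬝ᵥ ((K j).conjTranspose * K j).mulVec y =
        ((‖(WithLp.toLp 2 ((K j).mulVec y) : EuclideanSpace ℂ A')‖ ^ 2 : ℝ) : ℂ) := by
      intro j
      rw [← Matrix.mulVec_mulVec, Matrix.dotProduct_mulVec, ← Matrix.star_mulVec,
        EuclideanSpace.norm_sq_eq]
      simp [dotProduct, Complex.conj_mul']
    have h2 : star y ⬝ᵥ y = ((‖x‖ ^ 2 : ℝ) : ℂ) := by
      rw [EuclideanSpace.norm_sq_eq]
      simp [dotProduct, Complex.conj_mul', x]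
    rw [Matrix.sub_mulVec, Matrix.one_mulVec, Matrix.sum_mulVec, dotProduct_sub,
      dotProduct_sum]
    simp only [h1, h2]
    rw [← Complex.ofReal_sum, ← Complex.ofReal_sub, Complex.zero_le_real, sub_nonneg]
    exact h x

/-- The operator `∑ j, k j |x j⟩⟨u (e j)|`. -/
def transfer {A C I J : Type} [Fintype J] (u : I → EuclideanSpace ℂ A) (e : J → I) (k : J → ℂ)
    (x : J → EuclideanSpace ℂ C) : Matrix C A ℂ :=
  Matrix.of fun c a => ∑ j, k j * (x j c * star (u (e j) a))

theorem transfer_mulVec {A C I J : Type} [Fintype A] [Fintype J] (u : I → EuclideanSpace ℂ A)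
    (e : J → I) (k : J → ℂ) (x : J → EuclideanSpace ℂ C) (z : EuclideanSpace ℂ A) :
    (WithLp.toLp 2 ((transfer u e k x).mulVec z) : EuclideanSpace ℂ C) =
      ∑ j, (k j * inner ℂ (u (e j)) z) • x j := by
  ext c
  simp only [transfer, Matrix.mulVec, dotProduct, Matrix.of_apply, Finset.sum_mul, inner_euclidean,
    WithLp.ofLp_sum, Finset.sum_apply, PiLp.smul_apply, smul_eq_mul, Finset.mul_sum]
  rw [Finset.sum_comm]
  exact Finset.sum_congr rfl fun j _ => Finset.sum_congr rfl fun a _ => by ring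

theorem norm_transfer_mulVec_sq {A C I J : Type} [Fintype A] [Fintype C] [Fintype J]
    (u : I → EuclideanSpace ℂ A) (e : J → I) (k : J → ℂ) {x : J → EuclideanSpace ℂ C}
    (hx : Orthonormal ℂ x) (z : EuclideanSpace ℂ A) :
    ‖(WithLp.toLp 2 ((transfer u e k x).mulVec z) : EuclideanSpace ℂ C)‖ ^ 2 =
      ∑ j, ‖k j‖ ^ 2 * ‖inner ℂ (u (e j)) z‖ ^ 2 := by
  rw [transfer_mulVec, norm_sq_sum_smul hx]
  simp [mul_pow]

/-- Orthonormality of `u` makes the operator select the Schmidt terms with index `e j` and replace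
their left factor by `x j`. -/
theorem applyA_transfer {A B C I J : Type} [Fintype A] [Fintype I] [Fintype J]
    {u : I → EuclideanSpace ℂ A} (hu : Orthonormal ℂ u) (e : J → I) (k : J → ℂ)
    (x : J → EuclideanSpace ℂ C) (s : I → ℂ) (v : I → EuclideanSpace ℂ B) {χ : A × B → ℂ}
    (hχ : ∀ a b, χ (a, b) = ∑ i, s i * (u i a * v i b)) (c : C) (b : B) :
    applyA (transfer u e k x) χ (c, b) = ∑ j, (k j * s (e j)) * (x j c * v (e j) b) := by
  classical
  have h' : ∀ i, (transfer u e k x).mulVec (u i) c =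
      ∑ j, k j * (if e j = i then 1 else 0) * x j c := by
    intro i
    have := congrArg (fun z : EuclideanSpace ℂ C => z c) (transfer_mulVec u e k x (u i))
    simpa only [orthonormal_iff_ite.1 hu, WithLp.ofLp_sum, Finset.sum_apply, PiLp.smul_apply,
      smul_eq_mul] using this
  have h : applyA (transfer u e k x) χ (c, b) =
      ∑ i, s i * v i b * (transfer u e k x).mulVec (u i) c := by
    simp only [applyA, hχ, Matrix.mulVec, dotProduct, Finset.mul_sum]
    rw [Finset.sum_comm]
    exact Finset.sum_congr rfl fun i _ => Finset.sum_congr rfl fun a _ => by ring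
  rw [h]
  simp only [h', Finset.mul_sum]
  rw [Finset.sum_comm]
  refine Finset.sum_congr rfl fun j _ => ?_
  rw [Finset.sum_eq_single (e j) (fun i _ hi => by simp [hi.symm]) (by simp)]
  simp only [if_true]
  ring

/-- A vector can be converted into another one if the Schmidt coefficients of the target, moved by
a random injection, are bounded on average by the Schmidt coefficients of the source. -/
theorem convertible_of_random_injection {A B C D I J S : Type} [Fintype A] [Fintype B] [Fintype C]
    [Fintype D] [DecidableEq A] [DecidableEq B] [DecidableEq C] [DecidableEq D] [Fintype I]
    [Fintype J] [Fintype S] [DecidableEq I] [DecidableEq S] {ψ : A × B → ℂ} {φ : C × D → ℂ} {p : I → ℝ} {q : J → ℝ}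
    (hψ : SchmidtForm ψ p) (hφ : SchmidtForm φ q) {w : S → ℝ} {e : S → J ↪ I} (hw : ∀ s, 0 ≤ w s)
    (hw1 : ∑ s, w s = 1) (hload : ∀ i, ∑ s, ∑ j, (if e s j = i then w s * q j else 0) ≤ p i) :
    LOCCConvertible ψ φ := by
  obtain ⟨hp, u, v, hu, hv, hψ⟩ := hψ
  obtain ⟨hq, x, y, hx, hy, hφ⟩ := hφ
  have hwq : ∀ s j, 0 ≤ w s * q j := fun s j => mul_nonneg (hw s) (hq j)
  -- A filter turning the amplitude `√p` at `e s j` into `√(w s * q j)`. Where `p` vanishes the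
  -- quotient is 0, which is right since the load bound forces `w s * q j = 0`.
  let K : S → Matrix C A ℂ := fun s =>
    transfer u (e s) (fun j => (Real.sqrt (w s * q j / p (e s j)) : ℂ)) x
  -- The second party reads `s` from the register and moves its Schmidt vectors by a partial
  -- isometry.
  let L : S → Matrix D B ℂ := fun s => transfer v (e s) (fun _ => 1) y
  have hK : KrausBound K (fun _ => ()) := by
    rintro ⟨⟩
    refine posSemidef_one_sub_of_sum_norm_le K _ fun z => ?_
    simp only [K, norm_transfer_mulVec_sq _ _ _ hx, Finset.filter_true, Complex.norm_real,
      Real.norm_eq_abs, sq_abs, Real.sq_sqrt (div_nonneg (hwq _ _) (hp _))]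
    calc ∑ s, ∑ j, w s * q j / p (e s j) * ‖inner ℂ (u (e s j)) z‖ ^ 2
        = ∑ i, (∑ s, ∑ j, if e s j = i then w s * q j else 0) / p i * ‖inner ℂ (u i) z‖ ^ 2 := by
          simp only [Finset.sum_div, Finset.sum_mul]
          rw [Finset.sum_comm (s := (Finset.univ : Finset I))]
          refine Finset.sum_congr rfl fun s _ => ?_
          rw [Finset.sum_comm (s := (Finset.univ : Finset I))]
          refine Finset.sum_congr rfl fun j _ => ?_
          rw [Finset.sum_eq_single (e s j)]
          · simp
          · intro i _ hi
            simp [hi.symm]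
          · simp
      _ ≤ ∑ i, ‖inner ℂ (u i) z‖ ^ 2 := by
          refine Finset.sum_le_sum fun i _ => mul_le_of_le_one_left (sq_nonneg _) ?_
          exact div_le_one_of_le₀ (hload i) (hp i)
      _ ≤ ‖z‖ ^ 2 := hu.sum_inner_products_le z
  have hL : KrausBound L (id : S → S) := by
    intro s
    refine posSemidef_one_sub_of_sum_norm_le L _ fun z => ?_
    have : Finset.univ.filter (fun j : S => id j = s) = {s} := by ext; simp
    rw [this, Finset.sum_singleton]
    simp only [L, norm_transfer_mulVec_sq _ _ _ hy, norm_one, one_pow, one_mul]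
    exact (hv.comp _ (e s).injective).sum_inner_products_le z
  refine ⟨_, ((IsLOCC.refl (StateSpace.mk A B Unit)).stepA C S S K (fun _ => ()) id hK).stepB
    D Unit S L id (fun _ => ()) hL, ?_⟩
  have hKL : ∀ s, applyB (L s) (applyA (K s) ψ) = (Real.sqrt (w s) : ℂ) • φ := by
    intro s
    ext ⟨c, d⟩
    have h1 : ∀ b c, applyA (K s) ψ (c, b) =
        ∑ j, (Real.sqrt (w s * q j) : ℂ) * (v (e s j) b * x j c) := by
      intro b c
      rw [applyA_transfer hu _ _ _ _ _ hψ]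
      refine Finset.sum_congr rfl fun j _ => ?_
      have h0 : w s * q j ≤ p (e s j) := by
        refine le_trans ?_ (hload (e s j))
        refine le_trans ?_ (Finset.single_le_sum (f := fun s' => ∑ j',
          if e s' j' = e s j then w s' * q j' else 0) (fun s' _ => Finset.sum_nonneg fun j' _ => by
            split_ifs <;> simp [hwq]) (Finset.mem_univ s))
        refine le_trans ?_ (Finset.single_le_sum (f := fun j' =>
          if e s j' = e s j then w s * q j' else 0) (fun j' _ => by
            split_ifs <;> simp [hwq]) (Finset.mem_univ j))
        simp
      rw [← Complex.ofReal_mul, ← Real.sqrt_mul (div_nonneg (hwq _ _) (hp _)),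
        div_mul_cancel_of_imp, mul_comm (x j c)]
      intro h
      exact le_antisymm (h ▸ h0) (hwq s j)
    -- The second party's move is the same computation with the parties exchanged.
    have h2 := applyA_transfer (hv.comp _ (e s).injective) id (fun _ => 1) y
      (fun j => (Real.sqrt (w s * q j) : ℂ)) x (χ := fun z => applyA (K s) ψ z.swap)
      (fun b c => h1 b c) d c
    have h3 : applyB (L s) (applyA (K s) ψ) (c, d) =
      applyA (transfer (v ∘ e s) id (fun _ => 1) y) (fun z => applyA (K s) ψ z.swap) (d, c) := rfl
    rw [h3, h2]
    simp only [Pi.smul_apply, smul_eq_mul, hφ, Finset.mul_sum, id, Real.sqrt_mul (hw s)]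
    push_cast
    exact Finset.sum_congr rfl fun j _ => by ring
  have : ∀ s, Matrix.vecMulVec ((Real.sqrt (w s) : ℂ) • φ) (star ((Real.sqrt (w s) : ℂ) • φ)) =
      ((w s : ℝ) : ℂ) • Matrix.vecMulVec φ (star φ) := by
    intro s
    have h : ((Real.sqrt (w s) : ℝ) : ℂ) * (Real.sqrt (w s) : ℝ) = w s := by
      rw [← Complex.ofReal_mul, Real.mul_self_sqrt (hw s)]
    ext a b
    simp only [Matrix.vecMulVec_apply, Pi.smul_apply, Pi.star_apply, smul_eq_mul, star_mul',
      Matrix.smul_apply, Complex.star_def, Complex.conj_ofReal, ← h]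
    ring
  have hfin : stepB L id (fun _ => ()) (stepA K (fun _ => ()) (id : S → S) (pureState ψ)) =
      pureState φ := by
    funext z
    simp only [stepA, stepB, pureState, id, Finset.filter_true, Finset.filter_eq', Finset.mem_univ,
      if_true, Finset.sum_singleton, conj_vecMulVec, kronecker_one_mulVec, one_kronecker_mulVec,
      hKL]
    simp only [this, ← Finset.sum_smul, ← Complex.ofReal_sum, hw1, Complex.ofReal_one, one_smul]
  exact hfin

/-- A vector can be converted into another one if a transport matrix moves the Schmidt coefficients
of the target below those of the source. -/
theorem convertible_of_transport {A B C D I J : Type} [Fintype A] [Fintype B] [Fintype C]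
    [Fintype D] [DecidableEq A] [DecidableEq B] [DecidableEq C] [DecidableEq D] [Fintype I]
    [Fintype J] {ψ : A × B → ℂ} {φ : C × D → ℂ} {p : I → ℝ} {q : J → ℝ}
    (hψ : SchmidtForm ψ p) (hφ : SchmidtForm φ q) {T : I → J → ℝ} (hT : ∀ i j, 0 ≤ T i j)
    (hcol : ∀ j, ∑ i, T i j = 1) (hrow : ∀ i, ∑ j, T i j ≤ 1)
    (hload : ∀ i, ∑ j, T i j * q j ≤ p i) : LOCCConvertible ψ φ := by
  classical
  obtain ⟨S, _, w, e, hw, hw1, hT'⟩ := exists_injections_of_substochastic hT hcol hrow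
  refine convertible_of_random_injection hψ hφ (e := e) hw hw1 fun i => le_trans (le_of_eq ?_) (hload i)
  simp only [hT', Finset.sum_mul]
  rw [Finset.sum_comm]
  exact Finset.sum_congr rfl fun j _ => Finset.sum_congr rfl fun s _ => by split_ifs <;> simp

/-! ### Tilted distributions and their typical sequences -/

theorem sum_cons {ι : Type*} [Fintype ι] {n : ℕ} (f : (Fin (n + 1) → ι) → ℝ) :
    ∑ x, f x = ∑ i, ∑ x : Fin n → ι, f (Fin.cons i x) := by
  rw [← (Fin.consEquiv fun _ => ι).sum_comp, Fintype.sum_prod_type]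
  rfl

/-- Kills the cross term in the induction for the variance. -/
theorem sum_prod_mul_sum {ι : Type*} [Fintype ι] {w a : ι → ℝ} (hw : ∑ i, w i = 1)
    (ha : ∑ i, w i * a i = 0) (n : ℕ) :
    ∑ x : Fin n → ι, (∏ t, w (x t)) * ∑ t, a (x t) = 0 := by
  induction n with
  | zero => simp
  | succ n ih =>
    have h1 : ∑ x : Fin n → ι, ∏ t, w (x t) = 1 := by rw [sum_prod_eq_pow, hw, one_pow]
    rw [sum_cons]
    simp only [Fin.prod_univ_succ, Fin.sum_univ_succ, Fin.cons_zero, Fin.cons_succ]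
    calc ∑ i, ∑ x : Fin n → ι, w i * (∏ t, w (x t)) * (a i + ∑ t, a (x t))
        = ∑ i, (w i * a i * (∑ x : Fin n → ι, ∏ t, w (x t)) +
            w i * ∑ x : Fin n → ι, (∏ t, w (x t)) * ∑ t, a (x t)) := by
          refine Finset.sum_congr rfl fun i _ => ?_
          rw [Finset.mul_sum, Finset.mul_sum, ← Finset.sum_add_distrib]
          exact Finset.sum_congr rfl fun x _ => by ring
      _ = 0 := by simp [h1, ih, ha]

/-- The variance of a sum of independent centred random variables. -/
theorem sum_prod_mul_sum_sq {ι : Type*} [Fintype ι] {w a : ι → ℝ} (hw : ∑ i, w i = 1)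
    (ha : ∑ i, w i * a i = 0) (n : ℕ) :
    ∑ x : Fin n → ι, (∏ t, w (x t)) * (∑ t, a (x t)) ^ 2 = n * ∑ i, w i * a i ^ 2 := by
  induction n with
  | zero => simp
  | succ n ih =>
    have h1 : ∑ x : Fin n → ι, ∏ t, w (x t) = 1 := by rw [sum_prod_eq_pow, hw, one_pow]
    rw [sum_cons]
    simp only [Fin.prod_univ_succ, Fin.sum_univ_succ, Fin.cons_zero, Fin.cons_succ]
    calc ∑ i, ∑ x : Fin n → ι, w i * (∏ t, w (x t)) * (a i + ∑ t, a (x t)) ^ 2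
        = ∑ i, (w i * a i ^ 2 * (∑ x : Fin n → ι, ∏ t, w (x t)) +
            2 * (w i * a i) * (∑ x : Fin n → ι, (∏ t, w (x t)) * ∑ t, a (x t)) +
            w i * ∑ x : Fin n → ι, (∏ t, w (x t)) * (∑ t, a (x t)) ^ 2) := by
          refine Finset.sum_congr rfl fun i _ => ?_
          rw [Finset.mul_sum, Finset.mul_sum, Finset.mul_sum, ← Finset.sum_add_distrib,
            ← Finset.sum_add_distrib]
          exact Finset.sum_congr rfl fun x _ => by ring
      _ = _ := by
          simp only [h1, sum_prod_mul_sum hw ha, ih, mul_one, mul_zero, add_zero,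
            Finset.sum_add_distrib, ← Finset.sum_mul, hw]
          push_cast
          ring

/-- Chebyshev's inequality for sums of independent centred random variables. -/
theorem three_quarters_le_sum_typical {ι : Type*} [Fintype ι] {w a : ι → ℝ} (hw0 : ∀ i, 0 ≤ w i)
    (hw : ∑ i, w i = 1) (ha : ∑ i, w i * a i = 0) {C : ℝ} (hC : 0 < C) (haC : ∀ i, |a i| ≤ C)
    (n : ℕ) :
    3 / 4 ≤ ∑ x : Fin n → ι with |∑ t, a (x t)| ≤ 2 * C * Real.sqrt n, ∏ t, w (x t) := by
  have hw0' : ∀ x : Fin n → ι, 0 ≤ ∏ t, w (x t) := fun x => Finset.prod_nonneg fun t _ => hw0 _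
  have htot : ∑ x : Fin n → ι, ∏ t, w (x t) = 1 := by rw [sum_prod_eq_pow, hw, one_pow]
  rw [← Finset.sum_filter_add_sum_filter_not _
    (fun x : Fin n → ι => |∑ t, a (x t)| ≤ 2 * C * Real.sqrt n)] at htot
  rcases Nat.eq_zero_or_pos n with rfl | hn
  · simp only [Finset.univ_eq_empty, Finset.sum_empty, Finset.prod_empty]
    norm_num
  have hn' : (0 : ℝ) < n := by exact_mod_cast hn
  -- The variance is at most `C ^ 2 * n`, so a deviation beyond `2 * C * √n` has probability at most
  -- 1/4.
  suffices h : ∑ x : Fin n → ι with ¬ |∑ t, a (x t)| ≤ 2 * C * Real.sqrt n, ∏ t, w (x t) ≤ 1 / 4 by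
    linarith
  have hvar : ∑ i, w i * a i ^ 2 ≤ C ^ 2 := by
    calc ∑ i, w i * a i ^ 2 ≤ ∑ i, w i * C ^ 2 := Finset.sum_le_sum fun i _ =>
          mul_le_mul_of_nonneg_left (sq_le_sq' (abs_le.1 (haC i)).1 (abs_le.1 (haC i)).2) (hw0 i)
      _ = C ^ 2 := by rw [← Finset.sum_mul, hw, one_mul]
  have h1 : (∑ x : Fin n → ι with ¬ |∑ t, a (x t)| ≤ 2 * C * Real.sqrt n, ∏ t, w (x t)) *
      (4 * C ^ 2 * n) ≤ n * C ^ 2 := by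
    calc _ = ∑ x : Fin n → ι with ¬ |∑ t, a (x t)| ≤ 2 * C * Real.sqrt n,
          (∏ t, w (x t)) * (4 * C ^ 2 * n) := Finset.sum_mul _ _ _
      _ ≤ ∑ x : Fin n → ι with ¬ |∑ t, a (x t)| ≤ 2 * C * Real.sqrt n,
          (∏ t, w (x t)) * (∑ t, a (x t)) ^ 2 := by
          refine Finset.sum_le_sum fun x hx => mul_le_mul_of_nonneg_left ?_ (hw0' x)
          have hx := (not_le.1 (Finset.mem_filter.1 hx).2).le
          calc 4 * C ^ 2 * n = (2 * C * Real.sqrt n) ^ 2 := by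
                rw [mul_pow, mul_pow, Real.sq_sqrt hn'.le]; ring
            _ ≤ |∑ t, a (x t)| ^ 2 := by gcongr
            _ = _ := sq_abs _
      _ ≤ ∑ x : Fin n → ι, (∏ t, w (x t)) * (∑ t, a (x t)) ^ 2 :=
          Finset.sum_le_sum_of_subset_of_nonneg (Finset.filter_subset _ _)
            fun x _ _ => mul_nonneg (hw0' x) (sq_nonneg _)
      _ = n * ∑ i, w i * a i ^ 2 := sum_prod_mul_sum_sq hw ha n
      _ ≤ n * C ^ 2 := by gcongr
  have hpos : 0 < 4 * C ^ 2 * n := by positivity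
  rw [← le_div_iff₀ hpos] at h1
  refine h1.trans_eq ?_
  field_simp

/-- The expectation of `log p` under the distribution proportional to `p ^ α`. -/
noncomputable def tiltedMean {ι : Type*} [Fintype ι] (p : ι → ℝ) (α : ℝ) : ℝ :=
  (∑ i, p i ^ α * Real.log (p i)) / ∑ i, p i ^ α

/-- The entropy (in nats) of the distribution proportional to `p ^ α`. -/
noncomputable def tiltedEntropy {ι : Type*} [Fintype ι] (p : ι → ℝ) (α : ℝ) : ℝ :=
  Real.log (∑ i, p i ^ α) - α * tiltedMean p α

theorem sum_rpow_pos {ι : Type*} [Fintype ι] [Nonempty ι] {p : ι → ℝ} (hp : ∀ i, 0 < p i) (α : ℝ) :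
    0 < ∑ i, p i ^ α :=
  Finset.sum_pos (fun i _ => Real.rpow_pos_of_pos (hp i) _) Finset.univ_nonempty

/-- Typical sequences of tilted distributions, with bounds that are uniform in the tilt. -/
theorem exists_typical {ι : Type*} [Fintype ι] [Nonempty ι] {p : ι → ℝ} (hp : ∀ i, 0 < p i) :
    ∃ C : ℝ, 0 < C ∧ ∀ α ∈ Set.Icc (0 : ℝ) 1, ∀ n : ℕ, ∃ T : Finset (Fin n → ι),
      Real.exp (n * tiltedEntropy p α - C * Real.sqrt n) / 2 ≤ T.card ∧
      ∀ x ∈ T, Real.exp (n * tiltedMean p α - C * Real.sqrt n) ≤ ∏ t, p (x t) := by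
  -- Bounds every `|log (p i)|`, hence every tilted mean, whatever `α` is; this makes the final
  -- constant uniform in `α`.
  set M : ℝ := 1 + ∑ i, |Real.log (p i)| with hM
  have hMpos : 0 < M := by
    have : 0 ≤ ∑ i, |Real.log (p i)| := Finset.sum_nonneg fun i _ => abs_nonneg _
    linarith
  have hlog : ∀ i, |Real.log (p i)| ≤ M := fun i => by
    have := Finset.single_le_sum (f := fun i => |Real.log (p i)|) (fun i _ => abs_nonneg _)
      (Finset.mem_univ i)
    linarith
  refine ⟨2 * (2 * M), by positivity, fun α hα n => ?_⟩
  have hZ := sum_rpow_pos hp α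
  set Z := ∑ i, p i ^ α with hZdef
  set m := tiltedMean p α with hm
  let w : ι → ℝ := fun i => p i ^ α / Z
  let a : ι → ℝ := fun i => Real.log (p i) - m
  have hw0 : ∀ i, 0 < w i := fun i => div_pos (Real.rpow_pos_of_pos (hp i) _) hZ
  have hw : ∑ i, w i = 1 := by
    simp only [w]
    rw [← Finset.sum_div, div_self hZ.ne']
  have hmw : m = ∑ i, w i * Real.log (p i) := by
    simp only [w, hm, tiltedMean, Finset.sum_div]
    exact Finset.sum_congr rfl fun i _ => by rw [← hZdef]; ring
  have ha : ∑ i, w i * a i = 0 := by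
    simp only [a, mul_sub, Finset.sum_sub_distrib, ← Finset.sum_mul, hw]
    rw [← hmw]
    ring
  have hmM : |m| ≤ M := by
    rw [hmw]
    calc |∑ i, w i * Real.log (p i)| ≤ ∑ i, |w i * Real.log (p i)| :=
          Finset.abs_sum_le_sum_abs _ _
      _ ≤ ∑ i, w i * M := Finset.sum_le_sum fun i _ => by
          rw [abs_mul, abs_of_pos (hw0 i)]
          exact mul_le_mul_of_nonneg_left (hlog i) (hw0 i).le
      _ = M := by rw [← Finset.sum_mul, hw, one_mul]
  have haM : ∀ i, |a i| ≤ 2 * M := fun i => by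
    have := abs_sub (Real.log (p i)) m
    have := hlog i
    simp only [a]
    linarith
  have hT := three_quarters_le_sum_typical (fun i => (hw0 i).le) hw ha (by positivity : 0 < 2 * M)
    haM n
  set T : Finset (Fin n → ι) :=
    Finset.univ.filter fun x => |∑ t, a (x t)| ≤ 2 * (2 * M) * Real.sqrt n with hTdef
  have hsum : ∀ x : Fin n → ι, ∑ t, Real.log (p (x t)) = ∑ t, a (x t) + n * m := by
    intro x
    simp [a, Finset.sum_sub_distrib]
  have hprod : ∀ x : Fin n → ι, ∏ t, p (x t) = Real.exp (∑ t, a (x t) + n * m) := by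
    intro x
    rw [← hsum, Real.exp_sum]
    exact Finset.prod_congr rfl fun t _ => (Real.exp_log (hp _)).symm
  have hprodw : ∀ x : Fin n → ι, ∏ t, w (x t) =
      Real.exp (α * (∑ t, a (x t) + n * m) - n * Real.log Z) := by
    intro x
    simp only [w]
    rw [Finset.prod_div_distrib, Real.finsetProd_rpow _ _ (fun t _ => (hp _).le), hprod,
      ← Real.exp_mul, Finset.prod_const, Finset.card_univ, Fintype.card_fin, Real.exp_sub,
      Real.exp_nat_mul, Real.exp_log hZ, mul_comm α]
  refine ⟨T, ?_, fun x hx => ?_⟩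
  -- A typical sequence has tilted probability at most `e ^ (-n h + C √n)`, here using `α ≤ 1`. As
  -- the set carries mass at least 3/4, it cannot be small.
  · have h1 : ∀ x ∈ T, ∏ t, w (x t) ≤
        Real.exp (-(n * tiltedEntropy p α - 2 * (2 * M) * Real.sqrt n)) := by
      intro x hx
      have hx := (abs_le.1 (Finset.mem_filter.1 hx).2).2
      rw [hprodw, Real.exp_le_exp, tiltedEntropy, ← hm, ← hZdef]
      have h0 : 0 ≤ 2 * (2 * M) * Real.sqrt n := by positivity
      have h2 : α * ∑ t, a (x t) ≤ 2 * (2 * M) * Real.sqrt n :=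
        (mul_le_mul_of_nonneg_left hx hα.1).trans (mul_le_of_le_one_left h0 hα.2)
      linarith
    have h2 := hT.trans (Finset.sum_le_card_nsmul _ _ _ h1)
    rw [nsmul_eq_mul, Real.exp_neg, ← div_eq_mul_inv, le_div_iff₀ (Real.exp_pos _)] at h2
    have := Real.exp_pos (n * tiltedEntropy p α - 2 * (2 * M) * Real.sqrt n)
    linarith
  · have hx := (abs_le.1 (Finset.mem_filter.1 hx).2).1
    rw [hprod, Real.exp_le_exp]
    linarith

theorem continuous_sum_rpow {ι : Type*} [Fintype ι] {p : ι → ℝ} (hp : ∀ i, 0 < p i) :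
    Continuous fun α : ℝ => ∑ i, p i ^ α :=
  continuous_finsetSum _ fun i _ => Real.continuous_const_rpow (hp i).ne'

theorem continuous_log_sum_rpow {ι : Type*} [Fintype ι] [Nonempty ι] {p : ι → ℝ}
    (hp : ∀ i, 0 < p i) : Continuous fun α : ℝ => Real.log (∑ i, p i ^ α) :=
  (continuous_sum_rpow hp).log fun α => (sum_rpow_pos hp α).ne'

theorem continuous_tiltedEntropy {ι : Type*} [Fintype ι] [Nonempty ι] {p : ι → ℝ}
    (hp : ∀ i, 0 < p i) : Continuous (tiltedEntropy p) := by
  refine (continuous_log_sum_rpow hp).sub (continuous_id.mul ?_)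
  refine Continuous.div ?_ (continuous_sum_rpow hp) fun α => (sum_rpow_pos hp α).ne'
  exact continuous_finsetSum _ fun i _ =>
    (Real.continuous_const_rpow (hp i).ne').mul continuous_const

theorem tiltedEntropy_zero {ι : Type*} [Fintype ι] (p : ι → ℝ) :
    tiltedEntropy p 0 = Real.log (Fintype.card ι) := by
  simp [tiltedEntropy]

/-- Every rate below the logarithm of the support size is the entropy of a tilted distribution, or
is at most the entropy of `p` itself. -/
theorem exists_tilt {ι : Type*} [Fintype ι] [Nonempty ι] {p : ι → ℝ} (hp : ∀ i, 0 < p i)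
    {η : ℝ} (hη : 0 < η) :
    ∃ α₀ : ℝ, 0 < α₀ ∧ α₀ ≤ 1 ∧ ∀ R ≤ Real.log (Fintype.card ι) - η,
      ∃ α, α₀ ≤ α ∧ α ≤ 1 ∧ R ≤ tiltedEntropy p α ∧ (tiltedEntropy p α = R ∨ α = 1) := by
  have hc := continuous_tiltedEntropy hp
  -- Tilts in `[0, ε)` have entropy above `log |ι| - η`, so the intermediate value theorem cannot
  -- return one of them.
  obtain ⟨ε, hε, hball⟩ := Metric.continuous_iff.1 hc 0 η hη
  refine ⟨min ε 1, lt_min hε one_pos, min_le_right _ _, fun R hR => ?_⟩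
  rcases le_or_gt R (tiltedEntropy p 1) with h1 | h1
  · exact ⟨1, min_le_right _ _, le_rfl, h1, Or.inr rfl⟩
  · have hR' : R ∈ Set.Icc (tiltedEntropy p 1) (tiltedEntropy p 0) :=
      ⟨h1.le, by rw [tiltedEntropy_zero]; linarith⟩
    obtain ⟨α, hα, hαR⟩ := intermediate_value_Icc' zero_le_one hc.continuousOn hR'
    refine ⟨α, ?_, hα.2, hαR.ge, Or.inl hαR⟩
    by_contra hlt
    have hαε : α < ε := (not_le.1 hlt).trans_le (min_le_left _ _)
    have := hball α (by rw [Real.dist_eq, sub_zero, abs_of_nonneg hα.1]; exact hαε)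
    rw [hαR, tiltedEntropy_zero, Real.dist_eq, abs_lt] at this
    linarith [this.1]

/-! ### The conversion protocol -/

/-- The target sequences are grouped into classes, and each of them is spread uniformly over a
large set of source sequences of high probability. -/
theorem convertible_of_classes {A B C D I J Γ : Type} [Fintype A] [Fintype B] [Fintype C]
    [Fintype D] [DecidableEq A] [DecidableEq B] [DecidableEq C] [DecidableEq D] [Fintype I]
    [Fintype J] [Fintype Γ] [DecidableEq Γ] {ψ : A × B → ℂ} {φ : C × D → ℂ} {p : I → ℝ} {q : J → ℝ}
    (hψ : SchmidtForm ψ p) (hφ : SchmidtForm φ q) (cl : J → Γ) (N : J → ℝ)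
    (hN : ∀ j, N j = (Finset.univ.filter fun j' => cl j' = cl j).card) (T : J → Finset I)
    (hT : ∀ j, Fintype.card Γ * N j ≤ (T j).card)
    (hload : ∀ j, ∀ i ∈ T j, Fintype.card Γ * N j * q j ≤ (T j).card * p i) :
    LOCCConvertible ψ φ := by
  classical
  have hN0 : ∀ j, 0 < N j := fun j => by
    rw [hN]
    exact_mod_cast Finset.card_pos.2 ⟨j, by simp⟩
  have hΓ : ∀ j : J, (0 : ℝ) < Fintype.card Γ := fun j => by
    exact_mod_cast Fintype.card_pos_iff.2 ⟨cl j⟩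
  have hT0 : ∀ j, (0 : ℝ) < (T j).card := fun j => (mul_pos (hΓ j) (hN0 j)).trans_le (hT j)
  -- A budget `b` is shared equally by the classes and within each class; row sums and loads are
  -- both instances.
  have hclass : ∀ (f : J → ℝ) (b : ℝ), 0 ≤ b → (∀ j, f j ≤ b / (Fintype.card Γ * N j)) →
      ∑ j, f j ≤ b := by
    intro f b hb hf
    rw [← Finset.sum_fiberwise Finset.univ cl f]
    calc ∑ γ, ∑ j with cl j = γ, f j ≤ ∑ _γ : Γ, b / Fintype.card Γ := by
          refine Finset.sum_le_sum fun γ _ => ?_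
          rcases (Finset.univ.filter fun j => cl j = γ).eq_empty_or_nonempty with h | ⟨j₀, hj₀⟩
          · rw [h, Finset.sum_empty]
            positivity
          · have hj₀' := (Finset.mem_filter.1 hj₀).2
            refine (Finset.sum_le_card_nsmul _ f (b / (Fintype.card Γ * N j₀)) ?_).trans_eq ?_
            · intro j hj
              have : N j = N j₀ := by
                rw [hN, hN, (Finset.mem_filter.1 hj).2, hj₀']
              rw [← this]
              exact hf j
            · rw [nsmul_eq_mul, ← hj₀', ← hN]
              have := hN0 j₀
              have := hΓ j₀
              field_simp
      _ ≤ b := by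
          rw [Finset.sum_const, Finset.card_univ, nsmul_eq_mul]
          rcases eq_or_ne (Fintype.card Γ : ℝ) 0 with h | h
          · rw [h, zero_mul]
            exact hb
          · rw [mul_div_cancel₀ _ h]
  refine convertible_of_transport hψ hφ (T := fun i j => if i ∈ T j then ((T j).card : ℝ)⁻¹ else 0)
    (fun i j => by split_ifs <;> positivity) (fun j => ?_) (fun i => ?_) (fun i => ?_)
  · rw [Finset.sum_ite_mem, Finset.univ_inter, Finset.sum_const, nsmul_eq_mul,
      mul_inv_cancel₀ (hT0 j).ne']
  · refine hclass _ 1 zero_le_one fun j => ?_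
    have := mul_pos (hΓ j) (hN0 j)
    split_ifs
    · rw [one_div]
      exact inv_anti₀ this (hT j)
    · positivity
  · refine hclass _ (p i) (hψ.1 i) fun j => ?_
    have h0 := mul_pos (hΓ j) (hN0 j)
    split_ifs with h
    · rw [le_div_iff₀ h0, inv_mul_eq_div, div_mul_eq_mul_div, div_le_iff₀ (hT0 j)]
      linarith [hload j i h]
    · rw [zero_mul]
      exact div_nonneg (hψ.1 i) h0.le

/-! ### Type classes and the exponent estimate -/

/-- The number of occurrences of each symbol in a sequence. -/
def typeClass {κ : Type} [DecidableEq κ] {m : ℕ} (x : Fin m → κ) : κ → Fin (m + 1) :=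
  fun k => ⟨(Finset.univ.filter fun t => x t = k).card,
    Nat.lt_succ_of_le ((Finset.card_le_univ _).trans_eq (Fintype.card_fin m))⟩

theorem prod_eq_of_typeClass_eq {κ : Type} [Fintype κ] [DecidableEq κ] {m : ℕ} (q : κ → ℝ)
    {x y : Fin m → κ} (h : typeClass x = typeClass y) : ∏ t, q (x t) = ∏ t, q (y t) := by
  have key : ∀ x : Fin m → κ, ∏ t, q (x t) = ∏ k, q k ^ (typeClass x k : ℕ) := by
    intro x
    rw [← Finset.prod_fiberwise Finset.univ x]
    refine Finset.prod_congr rfl fun k _ => ?_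
    rw [Finset.prod_congr rfl (g := fun _ => q k) fun t ht => by rw [(Finset.mem_filter.1 ht).2],
      Finset.prod_const]
    rfl
  rw [key, key, h]

/-- The members of a class contribute equal terms to the expansion of `(∑ q ^ α) ^ m`. This holds
for every `α`, so the tilt may depend on the class. -/
theorem card_typeClass_mul_rpow_le {κ : Type} [Fintype κ] [DecidableEq κ] {m : ℕ} {q : κ → ℝ}
    (hq : ∀ k, 0 < q k) (y : Fin m → κ) (α : ℝ) :
    ((Finset.univ.filter fun x : Fin m → κ => typeClass x = typeClass y).card : ℝ) *
      (∏ t, q (y t)) ^ α ≤ (∑ k, q k ^ α) ^ m := by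
  rw [← sum_prod_eq_pow, ← nsmul_eq_mul, ← Finset.sum_const]
  refine le_trans (le_of_eq ?_) (Finset.sum_le_sum_of_subset_of_nonneg (Finset.filter_subset
    (fun x : Fin m → κ => typeClass x = typeClass y) _)
    fun x _ _ => Finset.prod_nonneg fun t _ => Real.rpow_nonneg (hq _).le _)
  refine Finset.sum_congr rfl fun x hx => ?_
  rw [← prod_eq_of_typeClass_eq q (Finset.mem_filter.1 hx).2,
    Real.finsetProd_rpow _ _ fun t _ => (hq _).le]

/-- The exponent estimate: with `L = log (2 N)` for the number `N` of classes, `a` the logarithm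
of the size of a class and `b` the logarithm of the probability of its elements. -/
theorem exponent_estimate {n a b F h m r α α₀ L c : ℝ} (hα₀ : 0 < α₀) (hα : α₀ ≤ α) (hα1 : α ≤ 1)
    (hF1 : α = 1 → F = 0) (hh : h = F - α * m) (hL : 0 ≤ L) (hc : 0 ≤ c)
    (hab : a + α * b ≤ n * (r * α + F)) (hcase : n * h = L + a + c ∨ α = 1) :
    L + a + b ≤ n * h - c + (n * r + (L + 2 * c) * (1 + 1 / α₀)) + (n * m - c) := by
  have hα0 : 0 < α := hα₀.trans_le hα
  have h1 : 1 / α ≤ 1 / α₀ := one_div_le_one_div_of_le hα₀ hα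
  have h2 : 0 ≤ 1 / α₀ := by positivity
  have h3 : 0 ≤ (L + 2 * c) * (1 / α₀) := by positivity
  -- If the tilt matches the class size, `(n * F - a) / α` equals `n * m` up to `(L + c) / α`. If `α
  -- = 1`, then `F = 0` and `h = -m`, so the claim reduces to `a + b ≤ n * r`.
  rcases hcase with hR | rfl
  · have hb : b ≤ (n * (r * α + F) - a) / α := by
      rw [le_div_iff₀ hα0]; linarith
    have hm : n * m = (n * F - n * h) / α := by
      rw [hh]; field_simp; ring
    have hb' : (n * (r * α + F) - a) / α = n * r + (n * F - a) / α := by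
      field_simp; ring
    have h4 : (n * F - a) / α - (n * F - n * h) / α = (L + c) * (1 / α) := by
      rw [hR]; field_simp; ring
    have h5 : (L + c) * (1 / α) ≤ (L + 2 * c) * (1 / α₀) := by
      apply mul_le_mul _ h1 (by positivity) (by positivity)
      linarith
    nlinarith
  · have hF := hF1 rfl
    subst hh
    rw [hF] at hab ⊢
    nlinarith

/-- One-shot form of the protocol for tensor powers. -/
theorem convertible_tensorPow {A B C D ι κ : Type} [Fintype A] [Fintype B] [Fintype C]
    [Fintype D] [DecidableEq A] [DecidableEq B] [DecidableEq C] [DecidableEq D] [Fintype ι]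
    [Fintype κ] [Nonempty ι] {ψ : A × B → ℂ} {φ : C × D → ℂ} {p : ι → ℝ} {q : κ → ℝ}
    (hψ : SchmidtForm ψ p) (hφ : SchmidtForm φ q) (hp1 : ∑ i, p i = 1)
    (hq : ∀ k, 0 < q k) {K η α₀ : ℝ} (hK : 0 ≤ K)
    (hα₀ : 0 < α₀)
    (htyp : ∀ α ∈ Set.Icc (0 : ℝ) 1, ∀ n : ℕ, ∃ T : Finset (Fin n → ι),
      Real.exp (n * tiltedEntropy p α - K * Real.sqrt n) / 2 ≤ T.card ∧
      ∀ x ∈ T, Real.exp (n * tiltedMean p α - K * Real.sqrt n) ≤ ∏ t, p (x t))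
    (htilt : ∀ R ≤ Real.log (Fintype.card ι) - η, ∃ α, α₀ ≤ α ∧ α ≤ 1 ∧ R ≤ tiltedEntropy p α ∧
      (tiltedEntropy p α = R ∨ α = 1)) {r : ℝ} {n m : ℕ} (hn : 0 < n)
    (hrate : ∀ α, 0 < α → α ≤ 1 →
      m * Real.log (∑ k, q k ^ α) ≤ n * (r * α + Real.log (∑ i, p i ^ α)))
    (hrank : Real.log (2 * (m + 1) ^ Fintype.card κ) + m * Real.log (Fintype.card κ) +
      K * Real.sqrt n ≤ n * (Real.log (Fintype.card ι) - η)) :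
    LOCCConvertible (((Real.exp ((n * r + (Real.log (2 * (m + 1) ^ Fintype.card κ) +
      2 * (K * Real.sqrt n)) * (1 + 1 / α₀)) / 2) : ℝ) : ℂ) • tensorPow ψ n) (tensorPow φ m) := by
  classical
  -- The number of classes, doubled to offset the factor 1/2 in the size bound for typical sets.
  set L := Real.log (2 * ((m : ℝ) + 1) ^ Fintype.card κ) with hL
  set c := K * Real.sqrt n with hc
  have hc0 : 0 ≤ c := by positivity
  have hNp : (1 : ℝ) ≤ ((m : ℝ) + 1) ^ Fintype.card κ := one_le_pow₀ (by linarith [m.cast_nonneg (α := ℝ)])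
  have hL0 : 0 ≤ L := Real.log_nonneg (by linarith)
  have hexpL : Real.exp L = 2 * ((m : ℝ) + 1) ^ Fintype.card κ := Real.exp_log (by linarith)
  have hn' : (0 : ℝ) < n := by exact_mod_cast hn
  let N : (Fin m → κ) → ℝ := fun y =>
    (Finset.univ.filter fun x : Fin m → κ => typeClass x = typeClass y).card
  have hN0 : ∀ y, 0 < N y := fun y => by
    have : 0 < (Finset.univ.filter fun x : Fin m → κ => typeClass x = typeClass y).card :=
      Finset.card_pos.2 ⟨y, by simp⟩
    exact Nat.cast_pos.2 this
  have hlogN : ∀ y, Real.log (N y) ≤ m * Real.log (Fintype.card κ) := fun y => by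
    rw [← Real.log_pow]
    refine Real.log_le_log (hN0 y) ?_
    have := Finset.card_le_univ
      (Finset.univ.filter fun x : Fin m → κ => typeClass x = typeClass y)
    rw [Fintype.card_fun, Fintype.card_fin] at this
    rw [← Nat.cast_pow]
    exact Nat.cast_le.2 this
  have hcard : (Fintype.card (κ → Fin (m + 1)) : ℝ) = ((m : ℝ) + 1) ^ Fintype.card κ := by
    simp
  have hchoice : ∀ y : Fin m → κ, ∃ T : Finset (Fin n → ι),
      2 * ((m : ℝ) + 1) ^ Fintype.card κ * N y ≤ 2 * T.card ∧
      ∀ x ∈ T, 2 * ((m : ℝ) + 1) ^ Fintype.card κ * N y * ∏ t, q (y t) ≤ 2 * T.card *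
        (Real.exp (n * r + (L + 2 * c) * (1 + 1 / α₀)) * ∏ t, p (x t)) := by
    intro y
    -- The entropy required to accommodate the class together with the overheads `L` and `c`.
    obtain ⟨α, hα, hα1, hR, hcase⟩ := htilt ((L + Real.log (N y) + c) / n) (by
      rw [div_le_iff₀ hn']
      linarith [hlogN y])
    rw [div_le_iff₀ hn', mul_comm] at hR
    have hcase' : n * tiltedEntropy p α = L + Real.log (N y) + c ∨ α = 1 :=
      hcase.imp_left fun h => by rw [h]; field_simp
    obtain ⟨T, hT, hTp⟩ := htyp α ⟨(hα₀.trans_le hα).le, hα1⟩ n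
    rw [← hc] at hT hTp
    rw [div_le_iff₀ two_pos, mul_comm (T.card : ℝ)] at hT
    have hqy : 0 < ∏ t, q (y t) := Finset.prod_pos fun t _ => hq _
    refine ⟨T, le_trans ?_ hT, fun x hx => ?_⟩
    · rw [← hexpL, ← Real.exp_log (hN0 y), ← Real.exp_add, Real.exp_le_exp]
      linarith
    · have hab : Real.log (N y) + α * Real.log (∏ t, q (y t)) ≤
          n * (r * α + Real.log (∑ i, p i ^ α)) := by
        refine le_trans ?_ (hrate α (hα₀.trans_le hα) hα1)
        rw [← Real.log_rpow hqy, ← Real.log_mul (hN0 y).ne' (Real.rpow_pos_of_pos hqy _).ne',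
          ← Real.log_pow]
        exact Real.log_le_log (mul_pos (hN0 y) (Real.rpow_pos_of_pos hqy _))
          (card_typeClass_mul_rpow_le hq y α)
      have hest := exponent_estimate hα₀ hα hα1 (fun h => by simp [h, hp1]) rfl hL0 hc0 hab
        hcase'
      calc 2 * ((m : ℝ) + 1) ^ Fintype.card κ * N y * ∏ t, q (y t)
          = Real.exp (L + Real.log (N y) + Real.log (∏ t, q (y t))) := by
            rw [Real.exp_add, Real.exp_add, hexpL, Real.exp_log (hN0 y), Real.exp_log hqy]
        _ ≤ Real.exp (n * tiltedEntropy p α - c) *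
            (Real.exp (n * r + (L + 2 * c) * (1 + 1 / α₀)) *
              Real.exp (n * tiltedMean p α - c)) := by
            rw [← Real.exp_add, ← Real.exp_add, Real.exp_le_exp]
            exact hest.trans_eq (add_assoc _ _ _)
        _ ≤ _ := by
            refine mul_le_mul hT (mul_le_mul_of_nonneg_left (hTp x hx) (Real.exp_pos _).le)
              (by positivity) (by positivity)
  choose T hT hTp using hchoice
  have hscale : ‖((Real.exp ((n * r + (L + 2 * c) * (1 + 1 / α₀)) / 2) : ℝ) : ℂ)‖ ^ 2 =
      Real.exp (n * r + (L + 2 * c) * (1 + 1 / α₀)) := by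
    rw [Complex.norm_real, Real.norm_of_nonneg (Real.exp_pos _).le, ← Real.exp_nat_mul]
    congr 1
    push_cast
    ring
  refine convertible_of_classes ((hψ.tensorPow n).smul _) (hφ.tensorPow m) typeClass N
    (fun _ => rfl) T (fun y => ?_) (fun y x hx => ?_)
  · rw [hcard]
    linarith [hT y]
  · rw [hcard, hscale]
    linarith [hTp y x hx]

open Filter Asymptotics Topology

/-! ### Asymptotics -/

theorem isLittleO_sqrt_natCast :
    (fun n : ℕ => Real.sqrt n) =o[atTop] (fun n : ℕ => (n : ℝ)) := by
  refine IsLittleO.of_bound fun c hc => ?_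
  filter_upwards [tendsto_natCast_atTop_atTop.eventually_ge_atTop ((1 / c) ^ 2)] with n hn
  have h := Real.le_sqrt_of_sq_le hn
  rw [Real.norm_of_nonneg (Real.sqrt_nonneg _), Real.norm_of_nonneg (Nat.cast_nonneg _)]
  rw [div_le_iff₀ hc] at h
  calc Real.sqrt n ≤ Real.sqrt n * (Real.sqrt n * c) :=
        le_mul_of_one_le_right (Real.sqrt_nonneg _) h
    _ = c * n := by rw [← mul_assoc, Real.mul_self_sqrt (Nat.cast_nonneg _), mul_comm]

/-- The number of classes is polynomial in `n`; the crude bound `log x ≤ 2 * √x` already makes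
everything `O(√n)`. -/
theorem isLittleO_log_card_add_sqrt {τ : ℝ} (hτ : 0 ≤ τ) (k : ℕ) {K : ℝ} (hK : 0 ≤ K) :
    (fun n : ℕ => Real.log (2 * ((⌊τ * n⌋₊ : ℝ) + 1) ^ k) + 2 * (K * Real.sqrt n)) =o[atTop]
      (fun n : ℕ => (n : ℝ)) := by
  refine IsBigO.trans_isLittleO ?_ isLittleO_sqrt_natCast
  refine IsBigO.of_bound (Real.log 2 + k * (2 * Real.sqrt (τ + 1)) + 2 * K) ?_
  filter_upwards [eventually_ge_atTop 1] with n hn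
  have hn' : (1 : ℝ) ≤ n := by exact_mod_cast hn
  have hs : 1 ≤ Real.sqrt n := Real.one_le_sqrt.2 hn'
  set m : ℝ := (⌊τ * n⌋₊ : ℝ) with hm
  have hm0 : 0 ≤ m := Nat.cast_nonneg _
  have hmτ : m ≤ τ * n := Nat.floor_le (by positivity)
  have hlog2 : 0 ≤ Real.log 2 := Real.log_nonneg (by norm_num)
  have hlog : Real.log (m + 1) ≤ 2 * Real.sqrt (τ + 1) * Real.sqrt n := by
    have h1 : Real.log (m + 1) = 2 * Real.log (Real.sqrt (m + 1)) := by
      rw [Real.log_sqrt (by linarith)]; ring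
    have h2 := Real.log_le_sub_one_of_pos (Real.sqrt_pos.2 (by linarith : 0 < m + 1))
    have h3 : Real.sqrt (m + 1) ≤ Real.sqrt (τ + 1) * Real.sqrt n := by
      rw [← Real.sqrt_mul (by linarith)]
      exact Real.sqrt_le_sqrt (by nlinarith)
    linarith
  have hlog0 : 0 ≤ Real.log (m + 1) := Real.log_nonneg (by linarith)
  have hpow : (m + 1) ^ k ≠ 0 := by positivity
  rw [Real.log_mul two_ne_zero hpow, Real.log_pow, Real.norm_of_nonneg (by positivity),
    Real.norm_of_nonneg (by positivity)]
  have h4 : (k : ℝ) * Real.log (m + 1) ≤ k * (2 * Real.sqrt (τ + 1) * Real.sqrt n) := by gcongr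
  nlinarith

theorem one_le_sum_rpow {κ : Type*} [Fintype κ] {q : κ → ℝ} (hq : ∀ k, 0 < q k)
    (hq1 : ∑ k, q k = 1) {α : ℝ} (hα : α ≤ 1) : 1 ≤ ∑ k, q k ^ α := by
  rw [← hq1]
  refine Finset.sum_le_sum fun k _ => ?_
  have : q k ≤ 1 := hq1 ▸ Finset.single_le_sum (fun j _ => (hq j).le) (Finset.mem_univ k)
  simpa using Real.rpow_le_rpow_of_exponent_ge (hq k) this hα

/-- Entanglement of the target enters here: it makes the denominators of the rate formula positive.
-/
theorem one_lt_sum_rpow {κ : Type*} [Fintype κ] {q : κ → ℝ} (hq : ∀ k, 0 < q k)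
    (hq1 : ∑ k, q k = 1) (hq2 : ∀ k, q k ≠ 1) {α : ℝ} (hα : α < 1) : 1 < ∑ k, q k ^ α := by
  have hne : (Finset.univ : Finset κ).Nonempty := by
    rw [Finset.nonempty_iff_ne_empty]
    rintro h
    simp [h] at hq1
  rw [← hq1]
  refine Finset.sum_lt_sum_of_nonempty hne fun k _ => ?_
  have : q k ≤ 1 := hq1 ▸ Finset.single_le_sum (fun j _ => (hq j).le) (Finset.mem_univ k)
  simpa using Real.rpow_lt_rpow_of_exponent_gt (hq k) (lt_of_le_of_ne this (hq2 k)) hα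

/-- Rates below the claimed optimum are achievable. -/
theorem mem_achievableRates {A B C D ι κ : Type} [Fintype A] [Fintype B] [Fintype C]
    [Fintype D] [DecidableEq A] [DecidableEq B] [DecidableEq C] [DecidableEq D] [Fintype ι]
    [Fintype κ] {ψ : A × B → ℂ} {φ : C × D → ℂ} {p : ι → ℝ} {q : κ → ℝ}
    (hψ : SchmidtForm ψ p) (hφ : SchmidtForm φ q) (hp : ∀ i, 0 < p i) (hp1 : ∑ i, p i = 1)
    (hq : ∀ k, 0 < q k) (hq1 : ∑ k, q k = 1) {r τ : ℝ} (hτ : 0 ≤ τ)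
    (hrate : ∀ α, 0 < α → α ≤ 1 →
      τ * Real.log (∑ k, q k ^ α) ≤ r * Real.log 2 * α + Real.log (∑ i, p i ^ α))
    (hrank : τ * Real.log (Fintype.card κ) < Real.log (Fintype.card ι)) :
    τ ∈ achievableRates r ψ φ := by
  have : Nonempty ι := by
    by_contra h
    rw [not_nonempty_iff] at h
    simp at hp1
  obtain ⟨K, hK, htyp⟩ := exists_typical hp
  -- Half of the gap at `α = 0`: one `η` bounds the tilts away from 0, the other absorbs the `o(n)`
  -- terms.
  obtain ⟨η, hη, hη2⟩ : ∃ η, 0 < η ∧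
      τ * Real.log (Fintype.card κ) + 2 * η = Real.log (Fintype.card ι) :=
    ⟨(Real.log (Fintype.card ι) - τ * Real.log (Fintype.card κ)) / 2, by linarith, by ring⟩
  obtain ⟨α₀, hα₀, -, htilt⟩ := exists_tilt hp hη
  have hlog2 : Real.log 2 ≠ 0 := (Real.log_pos (by norm_num)).ne'
  have hE := isLittleO_log_card_add_sqrt hτ (Fintype.card κ) hK.le
  -- The factor `1 / (2 * log 2)` passes from probabilities to amplitudes and from base `e` to base
  -- 2.
  refine ⟨hτ, fun n => (1 + 1 / α₀) / (2 * Real.log 2) *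
    (Real.log (2 * ((⌊τ * n⌋₊ : ℝ) + 1) ^ Fintype.card κ) + 2 * (K * Real.sqrt n)),
    hE.const_mul_left _, ?_⟩
  filter_upwards [hE.bound hη, eventually_gt_atTop 0] with n hn hn0
  have hn0' : (0 : ℝ) < n := by exact_mod_cast hn0
  have hm : (⌊τ * n⌋₊ : ℝ) ≤ τ * n := Nat.floor_le (by positivity)
  rw [Real.norm_of_nonneg hn0'.le] at hn
  have hn := (le_abs_self _).trans hn
  have hcκ : 0 ≤ Real.log (Fintype.card κ) := Real.log_natCast_nonneg _
  have key := convertible_tensorPow (r := r * Real.log 2) hψ hφ hp1 hq hK.le hα₀ htyp htilt hn0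
    (m := ⌊τ * n⌋₊) (fun α hα hα1 => ?_) ?_
  · convert key using 4
    rw [Real.rpow_def_of_pos two_pos]
    congr 1
    field_simp
  · calc (⌊τ * n⌋₊ : ℝ) * Real.log (∑ k, q k ^ α) ≤ τ * n * Real.log (∑ k, q k ^ α) :=
        mul_le_mul_of_nonneg_right hm (Real.log_nonneg (one_le_sum_rpow hq hq1 hα1))
      _ = n * (τ * Real.log (∑ k, q k ^ α)) := by ring
      _ ≤ _ := mul_le_mul_of_nonneg_left (hrate α hα hα1) hn0'.le
  · have h1 := mul_le_mul_of_nonneg_right hm hcκ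
    have h2 : 0 ≤ K * Real.sqrt n := by positivity
    rw [← hη2]
    nlinarith

/-- Achievable rates satisfy the claimed bounds. -/
theorem le_of_mem_achievableRates {A B C D ι κ : Type} [Fintype A] [Fintype B] [Fintype C]
    [Fintype D] [DecidableEq A] [DecidableEq B] [DecidableEq C] [DecidableEq D] [Fintype ι]
    [Fintype κ] {ψ : A × B → ℂ} {φ : C × D → ℂ} {p : ι → ℝ} {q : κ → ℝ}
    (hψ : SchmidtForm ψ p) (hφ : SchmidtForm φ q) (hp : ∀ i, 0 < p i) (hp1 : ∑ i, p i = 1)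
    (hq : ∀ k, 0 < q k) (hq1 : ∑ k, q k = 1) {r τ : ℝ} (hτ : τ ∈ achievableRates r ψ φ)
    {α : ℝ} (hα : 0 ≤ α) (hα1 : α < 1) :
    τ * Real.log (∑ k, q k ^ α) ≤ r * Real.log 2 * α + Real.log (∑ i, p i ^ α) := by
  have : Nonempty ι := by
    by_contra h
    rw [not_nonempty_iff] at h
    simp at hp1
  have : Nonempty κ := by
    by_contra h
    rw [not_nonempty_iff] at h
    simp at hq1
  obtain ⟨hτ0, δ, hδ, hconv⟩ := hτ
  have hmain : ∀ α, 0 < α → α < 1 →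
      τ * Real.log (∑ k, q k ^ α) ≤ r * Real.log 2 * α + Real.log (∑ i, p i ^ α) := by
    intro α hα hα1
    have hfloor : Tendsto (fun n : ℕ => (⌊τ * (n : ℝ)⌋₊ : ℝ) / n) atTop (𝓝 τ) :=
      (tendsto_nat_floor_mul_div_atTop hτ0).comp tendsto_natCast_atTop_atTop
    have h1 := hfloor.mul_const (Real.log (∑ k, q k ^ α))
    have h2 : Tendsto (fun n : ℕ => r * Real.log 2 * α + 2 * α * Real.log 2 * (δ n / n) +
        Real.log (∑ i, p i ^ α)) atTop
        (𝓝 (r * Real.log 2 * α + 2 * α * Real.log 2 * 0 + Real.log (∑ i, p i ^ α))) :=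
      ((hδ.tendsto_div_nhds_zero.const_mul _).const_add _).add_const _
    rw [mul_zero, add_zero] at h2
    refine le_of_tendsto_of_tendsto h1 h2 ?_
    filter_upwards [hconv, eventually_gt_atTop 0] with n hn hn0
    have hn0' : (0 : ℝ) < n := by exact_mod_cast hn0
    have h := pow_le_of_convertible hψ hφ hq1 hα hα1 (Real.rpow_nonneg two_pos.le _) hn
    have hZq := sum_rpow_pos hq α
    have hZp := sum_rpow_pos hp α
    have h2pos : (0 : ℝ) < 2 ^ ((n : ℝ) * r / 2 + δ n) := Real.rpow_pos_of_pos two_pos _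
    have h3 := Real.log_le_log (pow_pos hZq _) h
    rw [Real.log_mul (Real.rpow_pos_of_pos h2pos _).ne' (pow_pos hZp _).ne', Real.log_pow,
      Real.log_pow, Real.log_rpow h2pos, Real.log_rpow two_pos] at h3
    have h4 := div_le_div_of_nonneg_right h3 hn0'.le
    refine (le_of_eq ?_).trans (h4.trans (le_of_eq ?_))
    · ring
    · field_simp
  -- The quasi-norm argument needs `α > 0`; the Schmidt rank bound is its limit.
  rcases hα.eq_or_lt with rfl | hα
  · have hl : Tendsto (fun α => τ * Real.log (∑ k, q k ^ α)) (𝓝[>] (0 : ℝ))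
        (𝓝 (τ * Real.log (∑ k, q k ^ (0 : ℝ)))) :=
      ((continuous_log_sum_rpow hq).const_mul τ |>.tendsto 0).mono_left nhdsWithin_le_nhds
    have hr : Tendsto (fun α => r * Real.log 2 * α + Real.log (∑ i, p i ^ α)) (𝓝[>] (0 : ℝ))
        (𝓝 (r * Real.log 2 * 0 + Real.log (∑ i, p i ^ (0 : ℝ)))) :=
      (((continuous_id.const_mul (r * Real.log 2)).add (continuous_log_sum_rpow hp)).tendsto
        0).mono_left nhdsWithin_le_nhds
    refine le_of_tendsto_of_tendsto hl hr ?_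
    filter_upwards [Ioo_mem_nhdsGT (zero_lt_one' ℝ)] with α hα
    exact hmain α hα.1 hα.2
  · exact hmain α hα hα1

/-- Discarding the source is always possible. -/
theorem zero_mem_achievableRates {A B C D ι κ : Type} [Fintype A] [Fintype B] [Fintype C]
    [Fintype D] [DecidableEq A] [DecidableEq B] [DecidableEq C] [DecidableEq D] [Fintype ι]
    [Fintype κ] {ψ : A × B → ℂ} {φ : C × D → ℂ} {p : ι → ℝ} {q : κ → ℝ}
    (hψ : SchmidtForm ψ p) (hφ : SchmidtForm φ q) (hp1 : ∑ i, p i = 1) {r : ℝ} (hr : 0 ≤ r) :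
    (0 : ℝ) ∈ achievableRates r ψ φ := by
  refine ⟨le_rfl, fun _ => 0, isLittleO_zero _ _, Eventually.of_forall fun n => ?_⟩
  rw [zero_mul, Nat.floor_zero, add_zero]
  have hp0 : ∀ x : Fin n → ι, 0 ≤ ∏ t, p (x t) := fun x => Finset.prod_nonneg fun t _ => hψ.1 _
  have hsum : ∑ x : Fin n → ι, ∏ t, p (x t) = 1 := by rw [sum_prod_eq_pow, hp1, one_pow]
  -- Zero copies have the single coefficient 1, which is spread according to the source distribution
  -- itself; `r ≥ 0` ensures that the scaling does not shrink the source.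
  refine convertible_of_transport ((hψ.tensorPow n).smul _) (hφ.tensorPow 0)
    (T := fun x _ => ∏ t, p (x t)) (fun x _ => hp0 x) (fun _ => hsum) (fun x => ?_) (fun x => ?_)
  · simp only [Finset.univ_unique, Finset.sum_singleton]
    rw [← hsum]
    exact Finset.single_le_sum (fun x _ => hp0 x) (Finset.mem_univ x)
  · simp only [Finset.univ_unique, Finset.sum_singleton, Finset.univ_eq_empty, Finset.prod_empty,
      mul_one]
    refine le_mul_of_one_le_left (hp0 x) ?_
    have h2 : (1 : ℝ) ≤ 2 ^ ((n : ℝ) * r / 2) :=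
      Real.one_le_rpow (by norm_num) (by positivity)
    rw [Complex.norm_real, Real.norm_of_nonneg (by positivity)]
    exact one_le_pow₀ h2

/-! ### The optimal rate -/

/-- On the support the coefficients are positive, so their logarithms make sense and the index count
is the Schmidt rank. -/
theorem HasSchmidtDistribution.schmidtForm {A B : Type} [Fintype A] [Fintype B] {d : ℕ}
    {ψ : A × B → ℂ} {P : Fin d → ℝ} (h : HasSchmidtDistribution ψ P) (hP : ∀ i, 0 ≤ P i) :
    SchmidtForm ψ (fun i : {i // P i ≠ 0} => P i) := by
  obtain ⟨u, v, hu, hv, h⟩ := h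
  refine ⟨fun i => hP i, fun i => u i, fun i => v i, hu.comp _ Subtype.val_injective,
    hv.comp _ Subtype.val_injective, fun a b => ?_⟩
  rw [h, ← Finset.sum_filter_of_ne (p := fun i => P i ≠ 0)
    (fun i _ h hi => h (by simp [hi])), Finset.sum_subtype (p := fun i => P i ≠ 0) _ (by simp)]

theorem powerSum_eq {d : ℕ} (P : Fin d → ℝ) (α : ℝ) :
    powerSum P α = ∑ i : {i // P i ≠ 0}, (P i : ℝ) ^ α := by
  rw [powerSum, Finset.sum_subtype (p := fun i => P i ≠ 0) _ (by simp)]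

theorem sum_support_eq_one {d : ℕ} {P : Fin d → ℝ} (hP : P ∈ stdSimplex ℝ (Fin d)) :
    ∑ i : {i // P i ≠ 0}, P i = 1 := by
  rw [← hP.2, ← Finset.sum_filter_of_ne (s := Finset.univ) (f := P) (p := fun i => P i ≠ 0)
    fun i _ h => h]
  exact (Finset.sum_subtype (p := fun i => P i ≠ 0) (Finset.univ.filter fun i => P i ≠ 0)
    (by simp) P).symm

theorem extractionRate_eq {A B C D : Type} [Fintype A] [Fintype B] [Fintype C] [Fintype D]
    [DecidableEq A] [DecidableEq B] [DecidableEq C] [DecidableEq D] {d₁ d₂ : ℕ}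
    {r : ℝ} (hr : 0 ≤ r) {P : Fin d₁ → ℝ} (hP : P ∈ stdSimplex ℝ (Fin d₁))
    {Q : Fin d₂ → ℝ} (hQ : Q ∈ stdSimplex ℝ (Fin d₂)) {ψ : A × B → ℂ}
    (hψ : HasSchmidtDistribution ψ P) {φ : C × D → ℂ} (hφ : HasSchmidtDistribution φ Q)
    (hQ2 : ∀ i, Q i ≠ 1) :
    extractionRate r ψ φ = ⨅ α ∈ Set.Ico (0 : ℝ) 1,
      (((r * α + Real.logb 2 (powerSum P α)) / Real.logb 2 (powerSum Q α) : ℝ) : EReal) := by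
  have hψ' := hψ.schmidtForm hP.1
  have hφ' := hφ.schmidtForm hQ.1
  have hp : ∀ i : {i // P i ≠ 0}, 0 < P i := fun i => lt_of_le_of_ne (hP.1 i) i.2.symm
  have hq : ∀ i : {i // Q i ≠ 0}, 0 < Q i := fun i => lt_of_le_of_ne (hQ.1 i) i.2.symm
  have hp1 := sum_support_eq_one hP
  have hq1 := sum_support_eq_one hQ
  have hlog2 : 0 < Real.log 2 := Real.log_pos (by norm_num)
  have hZq : ∀ α : ℝ, α < 1 → 0 < Real.log (∑ i : {i // Q i ≠ 0}, (Q i : ℝ) ^ α) := fun α hα =>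
    Real.log_pos (one_lt_sum_rpow hq hq1 (fun k => hQ2 k) hα)
  have hval : ∀ α, (r * α + Real.logb 2 (powerSum P α)) / Real.logb 2 (powerSum Q α) =
      (r * Real.log 2 * α + Real.log (∑ i : {i // P i ≠ 0}, (P i : ℝ) ^ α)) /
        Real.log (∑ i : {i // Q i ≠ 0}, (Q i : ℝ) ^ α) := by
    intro α
    rw [powerSum_eq, powerSum_eq, Real.logb, Real.logb, ← mul_div_mul_right _ _ hlog2.ne',
      div_mul_cancel₀ _ hlog2.ne', add_mul, div_mul_cancel₀ _ hlog2.ne']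
    ring
  simp only [hval]
  refine le_antisymm ?_ ?_
  · refine iSup₂_le fun τ hτ => le_iInf₂ fun α hα => ?_
    rw [EReal.coe_le_coe_iff, le_div_iff₀ (hZq α hα.2)]
    exact le_of_mem_achievableRates hψ' hφ' hp hp1 hq hq1 hτ hα.1 hα.2
  -- A real strictly below the infimum gives strict inequalities, and the one at `α = 0` is the rank
  -- condition.
  · refine le_of_forall_lt fun c hc => ?_
    obtain ⟨τ, hcτ, hτ⟩ := EReal.lt_iff_exists_real_btwn.1 hc
    refine hcτ.trans_le ?_
    rcases le_or_gt τ 0 with hτ0 | hτ0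
    · exact (EReal.coe_le_coe_iff.2 hτ0).trans
        (le_iSup₂ (f := fun (τ : ℝ) (_ : τ ∈ achievableRates r ψ φ) => (τ : EReal)) 0
          (zero_mem_achievableRates hψ' hφ' hp1 hr))
    · have hlt : ∀ α ∈ Set.Ico (0 : ℝ) 1,
          τ * Real.log (∑ i : {i // Q i ≠ 0}, (Q i : ℝ) ^ α) <
            r * Real.log 2 * α + Real.log (∑ i : {i // P i ≠ 0}, (P i : ℝ) ^ α) := by
        intro α hα
        have := hτ.trans_le (iInf₂_le α hα)
        rwa [EReal.coe_lt_coe_iff, lt_div_iff₀ (hZq α hα.2)] at this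
      refine le_iSup₂ (f := fun (τ : ℝ) (_ : τ ∈ achievableRates r ψ φ) => (τ : EReal)) τ
        (mem_achievableRates hψ' hφ' hp hp1 hq hq1 hτ0.le (fun α hα hα1 => ?_) ?_)
      -- The infimum omits `α = 1`, where both logarithms vanish and the condition is just `r ≥ 0`.
      · rcases hα1.eq_or_lt with rfl | hα1
        · simp only [Real.rpow_one, hp1, hq1, Real.log_one]
          have := mul_nonneg hr hlog2.le
          linarith
        · exact (hlt α ⟨hα.le, hα1⟩).le
      · simpa using hlt 0 ⟨le_rfl, one_pos⟩

theorem bellState_hasSchmidtDistribution :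
    HasSchmidtDistribution bellState (fun _ : Fin 2 => (1 / 2 : ℝ)) := by
  refine ⟨fun i => EuclideanSpace.single i 1, fun i => EuclideanSpace.single i 1,
    EuclideanSpace.orthonormal_single, EuclideanSpace.orthonormal_single, fun a b => ?_⟩
  fin_cases a <;> fin_cases b <;> simp [bellState]

theorem logb_powerSum_half (α : ℝ) :
    Real.logb 2 (powerSum (fun _ : Fin 2 => (1 / 2 : ℝ)) α) = 1 - α := by
  have h : powerSum (fun _ : Fin 2 => (1 / 2 : ℝ)) α = 2 ^ (1 - α) := by
    rw [Real.rpow_sub two_pos, Real.rpow_one]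
    simp [powerSum, Real.inv_rpow, div_eq_mul_inv]
  rw [h, Real.logb_rpow two_pos (by norm_num)]

end BipartiteLOCC

theorem mainTheorem4 {A B C D : Type} [Fintype A] [Fintype B] [Fintype C] [Fintype D]
    [DecidableEq A] [DecidableEq B] [DecidableEq C] [DecidableEq D] {d₁ d₂ : ℕ}
    (r : ℝ) (hr : 0 ≤ r)
    (P : Fin d₁ → ℝ) (hP : P ∈ stdSimplex ℝ (Fin d₁))
    (Q : Fin d₂ → ℝ) (hQ : Q ∈ stdSimplex ℝ (Fin d₂))
    (ψ : A × B → ℂ) (hψ : BipartiteLOCC.HasSchmidtDistribution ψ P)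
    (φ : C × D → ℂ) (hφ : BipartiteLOCC.HasSchmidtDistribution φ Q)
    -- the target state is entangled
    (hQ2 : ∀ i, Q i ≠ 1) :
    (BipartiteLOCC.extractionRate r ψ φ =
        ⨅ α ∈ Set.Ico (0 : ℝ) 1,
          (((r * α + Real.logb 2 (BipartiteLOCC.powerSum P α)) /
            Real.logb 2 (BipartiteLOCC.powerSum Q α) : ℝ) : EReal)) ∧
    (BipartiteLOCC.extractionRate r ψ φ =
        ⨅ α ∈ Set.Ico (0 : ℝ) 1,
          (((r * (α / (1 - α)) + BipartiteLOCC.renyiEntropy α P) /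
            BipartiteLOCC.renyiEntropy α Q : ℝ) : EReal)) ∧
    -- the case of entanglement concentration, where the target is a Bell state
    (BipartiteLOCC.extractionRate r ψ BipartiteLOCC.bellState =
        ⨅ α ∈ Set.Ico (0 : ℝ) 1,
          (((r * α + Real.logb 2 (BipartiteLOCC.powerSum P α)) / (1 - α) : ℝ) : EReal)) ∧
    (BipartiteLOCC.extractionRate r ψ BipartiteLOCC.bellState =
        ⨅ α ∈ Set.Ico (0 : ℝ) 1,
          ((r * (α / (1 - α)) + BipartiteLOCC.renyiEntropy α P : ℝ) : EReal)) := by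

  have hbell := BipartiteLOCC.extractionRate_eq hr hP (Q := fun _ : Fin 2 => (1 / 2 : ℝ))
    ⟨fun _ => by norm_num, by norm_num⟩ hψ BipartiteLOCC.bellState_hasSchmidtDistribution
    (fun _ => by norm_num)
  simp only [BipartiteLOCC.logb_powerSum_half] at hbell
  refine ⟨BipartiteLOCC.extractionRate_eq hr hP hQ hψ hφ hQ2, ?_, hbell, ?_⟩
  · rw [BipartiteLOCC.extractionRate_eq hr hP hQ hψ hφ hQ2]
    refine iInf_congr fun α => iInf_congr fun hα => ?_
    have h : 1 - α ≠ 0 := (sub_pos.2 hα.2).ne'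
    rw [EReal.coe_eq_coe_iff, BipartiteLOCC.renyiEntropy, BipartiteLOCC.renyiEntropy,
      ← mul_div_assoc, one_div_mul_eq_div, one_div_mul_eq_div, ← add_div,
      div_div_div_cancel_right₀ h]
  · rw [hbell]
    refine iInf_congr fun α => iInf_congr fun _ => ?_
    rw [EReal.coe_eq_coe_iff, BipartiteLOCC.renyiEntropy, add_div, mul_div_assoc,
      one_div_mul_eq_div]
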